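/- All graphs are finite, simple and undirected. For a matching $M$ of a graph $G$ let $G[M]$ denote the subgraph of $G$ induced by the endpoints of the edges of $M$. The matching $M$ is \emph{induced} if $G[M]$ is $1$-regular or empty, and \emph{disconnected} if $G[M]$ is disconnected or empty. Let $\nu_s(G)$ and $\nu_d(G)$ be the maximum number of edges of an induced, respectively disconnected, matching of $G$. \textbf{Theorem.} For every fixed integer $D \ge 0$, the following decision problem can be solved in polynomial time: given a graph $G$ (by its adjacency matrix) with maximum degree $\Delta(G) \le D$, decide whether $\nu_d(G) = \nu_s(G)$. That is, for every $D$ there are a deterministic multi-tape Turing machine and a polynomial $p$ such that on every graph $G$ with $\Delta(G) \le D$ the machine, run on the adjacency matrix of $G$, halts after at most $p(\ell)$ steps, where $\ell$ is the length of this input, and answers correctly whether $\nu_d(G) = \nu_s(G)$. -/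

import Mathlib

namespace MatchingNumbers

/-- A matching `M` of `G` is induced if the subgraph `G[M]` of `G` induced by the saturated
vertices is 1-regular or empty. (For `M.IsMatching`, the set `M.verts` is exactly the set of
saturated vertices.) -/
def IsInducedMatching {V : Type} (G : SimpleGraph V) (M : G.Subgraph) : Prop :=
  M.IsMatching ∧ ∀ v : M.verts, ∃! w : M.verts, (G.induce M.verts).Adj v w

/-- A matching `M` of `G` is disconnected if the subgraph `G[M]` of `G` induced by the saturated
vertices is disconnected or empty. -/
def IsDisconnectedMatching {V : Type} (G : SimpleGraph V) (M : G.Subgraph) : Prop :=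
  M.IsMatching ∧ (M.verts = ∅ ∨ ¬ (G.induce M.verts).Preconnected)

/-- The induced matching number `ν_s(G)`: the largest number of edges of an induced matching.
For finite graphs this is a supremum of a bounded set that contains `0`. -/
noncomputable def inducedMatchingNumber {V : Type} (G : SimpleGraph V) : ℕ :=
  sSup {k | ∃ M : G.Subgraph, IsInducedMatching G M ∧ M.edgeSet.ncard = k}

/-- The disconnected matching number `ν_d(G)`: the largest number of edges of a disconnected
matching. -/
noncomputable def disconnectedMatchingNumber {V : Type} (G : SimpleGraph V) : ℕ :=
  sSup {k | ∃ M : G.Subgraph, IsDisconnectedMatching G M ∧ M.edgeSet.ncard = k}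

/-- Finite simple undirected graphs, on the vertex sets `{0, …, n - 1}`. -/
structure FinGraph : Type where
  /-- the number of vertices -/
  n : ℕ
  /-- the graph -/
  graph : SimpleGraph (Fin n)

open Classical in
/-- The maximum degree `Δ(G)`. -/
noncomputable def FinGraph.maxDegree (G : FinGraph) : ℕ :=
  G.graph.maxDegree

open Classical in
/-- The adjacency matrix of a graph as a string: its rows one after the other, the entries
being `some true` (adjacent) or `some false`, each row followed by the end marker `none`. -/
noncomputable def FinGraph.encode (G : FinGraph) : List (Option Bool) :=
  (List.finRange G.n).flatMap fun u =>
    (List.finRange G.n).map (fun v => some (decide (G.graph.Adj u v))) ++ [none]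

open Classical in
/-- The decision problem with the instances `a : α`, given to the machine as the strings `enc a`,
and the question "does `P a` hold?" is solved in polynomial time by a (multi-tape, deterministic)
Turing machine: on every instance it halts with output `true` or `false`, as `P a` is true
or false, within a number of steps that is polynomial in the length of the input string.
All tape alphabets are finite. -/
def DecidableInPolyTime {α Γ : Type} (enc : α → List Γ) (P : α → Prop) : Prop :=
  ∃ T : Turing.TM2ComputableInPolyTime enc Computability.encodeBool (fun a => decide (P a)),
    ∀ k, Finite (T.tm.Γ k)

end MatchingNumbers

namespace MatchingNumbers

/-! Let ν be the size of a maximum matching. For bounded degree, whether the two numbers agree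
depends only on which graphs of bounded order occur as induced subgraphs, with a record of the
vertices that have further neighbours (`numbers_eq_of_locallyEmbeds`).

If ν is below a constant depending on D, all matchings live on boundedly many vertices. If ν is
large, equality means that some maximum matching is induced (`numbers_eq_iff`). Indeed, deleting the
few edges near one edge of a maximum matching shows that the disconnected matching number is at
least ν - 2D. If an induced matching M has that size, a maximum matching chosen close to M differs
from it in boundedly many edges, so one of their many common edges is far from all the differences.
That edge is isolated from the rest, the maximum matching is disconnected, and equality forces |M| =
ν. Conversely, an induced matching with two edges is disconnected.

An induced maximum matching exists if and only if the local condition `GoodCover` holds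
(`IsInd.goodCover`, `GoodCover.exists_isInd`). Its good edges are those that are not the middle edge
of a path on four vertices.

For the algorithm, k marks run like an odometer through all placements on the vertices. A
finite-state scan of the matrix collects a code for each placement from a finite set of codes, and
the set of codes determines the local structure (`Marks.locallyEmbeds`). The answer is then read
from a fixed finite table. Such scans run on a Turing machine in polynomial time
(`Scanner.decidableInPolyTime`). -/

/-! ### Iterating a partial step function -/

/-- `b` is reached from `a` after exactly `t` applications of the partial function `f`. -/
def ReachesIn {α : Type*} (f : α → Option α) (a b : α) (t : ℕ) : Prop :=
  (flip bind f)^[t] (some a) = some b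

namespace ReachesIn

variable {α : Type*} {f : α → Option α} {a b c : α} {s t : ℕ}

theorem refl (a : α) : ReachesIn f a a 0 := rfl

theorem single (h : f a = some b) : ReachesIn f a b 1 := h

theorem trans (h₁ : ReachesIn f a b s) (h₂ : ReachesIn f b c t) : ReachesIn f a c (s + t) := by
  unfold ReachesIn at *
  rw [Nat.add_comm, Function.iterate_add_apply, h₁, h₂]

theorem head (h₁ : f a = some b) (h₂ : ReachesIn f b c t) : ReachesIn f a c (t + 1) := by
  rw [Nat.add_comm]; exact (single h₁).trans h₂

theorem exists_head (h : ReachesIn f a c (t + 1)) : ∃ b, f a = some b ∧ ReachesIn f b c t := by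
  rw [ReachesIn, Function.iterate_succ_apply] at h
  change (flip bind f)^[t] (f a) = some c at h
  cases hf : f a with
  | some b => exact ⟨b, rfl, by rwa [hf] at h⟩
  | none =>
    have : (flip bind f)^[t] none = none := Function.iterate_fixed rfl t
    rw [hf, this] at h
    cases h

end ReachesIn

/-! ### Finite-state scans of a square matrix -/

/-- A finite-state procedure that repeatedly passes over a square Boolean matrix, row by row. Every
index carries a label from `L`; an entry is read together with the labels of its row and its column,
and each row end may change the label of that row for the next pass. -/
structure Scanner (L Q : Type) where
  /-- reading an entry, given the label of the row and of the column -/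
  entry : Q → L → L → Bool → Q
  /-- the end of a row: the new state, and the new label of the row -/
  rowEnd : Q → L → Q × L
  /-- the end of a pass -/
  passEnd : Q → Q
  /-- the answer, if the state is final -/
  answer : Q → Option Bool
  /-- the initial label of all rows -/
  blank : L
  /-- the initial state -/
  start : Q

namespace Scanner

variable {L Q : Type} (S : Scanner L Q)

/-- Reading a row with label `a`, where `cols` are the labels of the columns. -/
def readRow (a : L) : Q → List Bool → List L → Q
  | q, b :: bs, c :: cs => readRow a (S.entry q a c b) bs cs
  | q, [], _ => q
  | q, _ :: _, [] => q

/-- Reading all rows. -/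
def readRows (cols : List L) : Q → List (List Bool) → List L → Q × List L
  | q, r :: rs, a :: as =>
    let x := S.rowEnd (S.readRow a q r cols) a
    let y := readRows cols x.1 rs as
    (y.1, x.2 :: y.2)
  | q, [], _ => (q, [])
  | q, _ :: _, [] => (q, [])

/-- A complete pass over the matrix. -/
def pass (rows : List (List Bool)) (x : Q × List L) : Q × List L :=
  let y := S.readRows x.2 x.1 rows x.2
  (S.passEnd y.1, y.2)

/-- A complete pass over the matrix, if it does not lead to a final state. -/
def passStep (rows : List (List Bool)) (x : Q × List L) : Option (Q × List L) :=
  if S.answer (S.pass rows x).1 = none then some (S.pass rows x) else none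

/-- The string encoding of a matrix. -/
def encodeRows (rows : List (List Bool)) : List (Option Bool) :=
  rows.flatMap fun r => r.map some ++ [none]

/-! ### The Turing machine of a scanner -/

/-- The contents of the machine. -/
inductive Stack
  | input | output | done | rows | cols | colsDone | newRows
  deriving DecidableEq

/-- The labels of the machine. -/
inductive Label
  | init | rewind | rowStart | entry | rewindCols | clearCols | rebuild | clearRows | clearInput
  deriving DecidableEq

instance : Fintype Stack :=
  ⟨{.input, .output, .done, .rows, .cols, .colsDone, .newRows}, fun k => by cases k <;> decide⟩

instance : Fintype Label :=
  ⟨{.init, .rewind, .rowStart, .entry, .rewindCols, .clearCols, .rebuild, .clearRows, .clearInput},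
    fun k => by cases k <;> decide⟩

/-- The stack alphabets. -/
def Alphabet (L : Type) : Stack → Type
  | .input => Option Bool
  | .output => Bool
  | .done => Option Bool
  | .rows => L
  | .cols => L
  | .colsDone => L
  | .newRows => L

/-- The internal states: the state of the scanner, a symbol of the matrix, the label of the current
row and another label. -/
abbrev Vars (L Q : Type) : Type := Q × Option (Option Bool) × Option L × Option L

/-- Forget everything but the state of the scanner. -/
def forget (v : Vars L Q) : Vars L Q := (v.1, none, none, none)

open Turing.TM2 Turing.TM2.Stmt

/-- The program. -/
def program : Label → Stmt (Alphabet L) Label (Vars L Q)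
  | .init =>
    pop .input (fun v s => (v.1, s, none, none)) <|
    branch (fun v => v.2.1.isSome)
      (push .done (fun v => v.2.1.getD none) <|
        branch (fun v => (v.2.1.getD none).isSome)
          -- Only the first row is read here: its length is the number of labels needed.
          (push .rows (fun _ => S.blank) <| push .cols (fun _ => S.blank) <|
            load forget <| goto fun _ => .init)
          (load forget <| goto fun _ => .rewind))
      (load forget <| goto fun _ => .rewind)
  | .rewind =>
    pop .done (fun v s => (v.1, s, none, none)) <|
    branch (fun v => v.2.1.isSome)
      (push .input (fun v => v.2.1.getD none) <| load forget <| goto fun _ => .rewind)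
      (load forget <| goto fun _ => .rowStart)
  | .rowStart =>
    pop .rows (fun v a => (v.1, none, a, none)) <|
    branch (fun v => v.2.2.1.isSome)
      (goto fun _ => .entry)
      (load forget <| goto fun _ => .clearCols)
  | .entry =>
    pop .input (fun v s => (v.1, s, v.2.2.1, none)) <|
    push .done (fun v => v.2.1.getD none) <|
    branch (fun v => (v.2.1.getD none).isSome)
      (pop .cols (fun v c => (v.1, v.2.1, v.2.2.1, c)) <|
        push .colsDone (fun v => v.2.2.2.getD S.blank) <|
        load (fun v => (S.entry v.1 (v.2.2.1.getD S.blank) (v.2.2.2.getD S.blank)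
          ((v.2.1.getD none).getD false), none, v.2.2.1, none)) <|
        goto fun _ => .entry)
      (push .newRows (fun v => (S.rowEnd v.1 (v.2.2.1.getD S.blank)).2) <|
        load (fun v => ((S.rowEnd v.1 (v.2.2.1.getD S.blank)).1, none, none, none)) <|
        goto fun _ => .rewindCols)
  | .rewindCols =>
    pop .colsDone (fun v c => (v.1, none, none, c)) <|
    branch (fun v => v.2.2.2.isSome)
      (push .cols (fun v => v.2.2.2.getD S.blank) <| load forget <| goto fun _ => .rewindCols)
      (load forget <| goto fun _ => .rowStart)
  | .clearCols =>
    pop .cols (fun v c => (v.1, none, none, c)) <|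
    branch (fun v => v.2.2.2.isSome)
      (load forget <| goto fun _ => .clearCols)
      (load (fun v => (S.passEnd v.1, none, none, none)) <|
        goto fun v => cond (S.answer v.1).isSome .clearRows .rebuild)
  | .rebuild =>
    pop .newRows (fun v c => (v.1, none, none, c)) <|
    branch (fun v => v.2.2.2.isSome)
      (push .rows (fun v => v.2.2.2.getD S.blank) <| push .cols (fun v => v.2.2.2.getD S.blank) <|
        load forget <| goto fun _ => .rebuild)
      (load forget <| goto fun _ => .rewind)
  | .clearRows =>
    pop .newRows (fun v c => (v.1, none, none, c)) <|
    branch (fun v => v.2.2.2.isSome)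
      (load forget <| goto fun _ => .clearRows)
      (load forget <| goto fun _ => .clearInput)
  | .clearInput =>
    pop .done (fun v s => (v.1, s, none, none)) <|
    branch (fun v => v.2.1.isSome)
      (load forget <| goto fun _ => .clearInput)
      -- A halting configuration must have its initial internal state and empty stacks except for
      -- the output; hence this reset and the clearing phases before it.
      (push .output (fun v => (S.answer v.1).getD false) <|
        load (fun _ => (S.start, none, none, none)) halt)

/-- The contents of the contents. -/
def contents (inp dn : List (Option Bool)) (out : List Bool) (R C C' N : List L) :
    ∀ k, List (Alphabet L k)
  | .input => inp
  | .output => out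
  | .done => dn
  | .rows => R
  | .cols => C
  | .colsDone => C'
  | .newRows => N

/-- Configurations of the machine with empty output. -/
def cfg (l : Label) (q : Q) (a : Option L) (inp dn : List (Option Bool)) (R C C' N : List L) :
    Cfg (Alphabet L) Label (Vars L Q) :=
  ⟨some l, (q, none, a, none), contents inp dn [] R C C' N⟩

/-- The final configuration with output `b`. -/
def finalCfg (b : Bool) : Cfg (Alphabet L) Label (Vars L Q) :=
  ⟨none, (S.start, none, none, none), contents [] [] [b] [] [] [] []⟩

theorem cfg_ext {l l' : Option Label} {v v' : Vars L Q} {s s' : ∀ k, List (Alphabet L k)}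
    (hl : l = l') (hv : v = v') (hs : ∀ k, s k = s' k) :
    (⟨l, v, s⟩ : Cfg (Alphabet L) Label (Vars L Q)) = ⟨l', v', s'⟩ := by
  obtain rfl := funext hs
  rw [hl, hv]

section Steps

variable (q : Q) (a c : L) (b : Bool) (s : Option Bool) (inp dn : List (Option Bool))
  (R C C' N : List L)

theorem step_init_some :
    step S.program (cfg .init q none (some b :: inp) dn R C C' N) =
      some (cfg .init q none inp (some b :: dn) (S.blank :: R) (S.blank :: C) C' N) :=
    congrArg some (cfg_ext rfl rfl fun k => by cases k <;> rfl)

theorem step_init_none :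
    step S.program (cfg .init q none (none :: inp) dn R C C' N) =
      some (cfg .rewind q none inp (none :: dn) R C C' N) :=
    congrArg some (cfg_ext rfl rfl fun k => by cases k <;> rfl)

theorem step_init_nil :
    step S.program (cfg .init q none [] dn R C C' N) =
      some (cfg .rewind q none [] dn R C C' N) :=
    congrArg some (cfg_ext rfl rfl fun k => by cases k <;> rfl)

theorem step_rewind_cons :
    step S.program (cfg .rewind q none inp (s :: dn) R C C' N) =
      some (cfg .rewind q none (s :: inp) dn R C C' N) :=
    congrArg some (cfg_ext rfl rfl fun k => by cases k <;> rfl)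

theorem step_rewind_nil :
    step S.program (cfg .rewind q none inp [] R C C' N) =
      some (cfg .rowStart q none inp [] R C C' N) :=
    congrArg some (cfg_ext rfl rfl fun k => by cases k <;> rfl)

theorem step_rowStart_cons :
    step S.program (cfg .rowStart q none inp dn (a :: R) C C' N) =
      some (cfg .entry q (some a) inp dn R C C' N) :=
    congrArg some (cfg_ext rfl rfl fun k => by cases k <;> rfl)

theorem step_rowStart_nil :
    step S.program (cfg .rowStart q none inp dn [] C C' N) =
      some (cfg .clearCols q none inp dn [] C C' N) :=
    congrArg some (cfg_ext rfl rfl fun k => by cases k <;> rfl)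

theorem step_entry_some :
    step S.program (cfg .entry q (some a) (some b :: inp) dn R (c :: C) C' N) =
      some (cfg .entry (S.entry q a c b) (some a) inp (some b :: dn) R C (c :: C') N) :=
    congrArg some (cfg_ext rfl rfl fun k => by cases k <;> rfl)

theorem step_entry_none :
    step S.program (cfg .entry q (some a) (none :: inp) dn R C C' N) =
      some (cfg .rewindCols (S.rowEnd q a).1 none inp (none :: dn) R C C'
        ((S.rowEnd q a).2 :: N)) :=
    congrArg some (cfg_ext rfl rfl fun k => by cases k <;> rfl)

theorem step_rewindCols_cons :
    step S.program (cfg .rewindCols q none inp dn R C (c :: C') N) =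
      some (cfg .rewindCols q none inp dn R (c :: C) C' N) :=
    congrArg some (cfg_ext rfl rfl fun k => by cases k <;> rfl)

theorem step_rewindCols_nil :
    step S.program (cfg .rewindCols q none inp dn R C [] N) =
      some (cfg .rowStart q none inp dn R C [] N) :=
    congrArg some (cfg_ext rfl rfl fun k => by cases k <;> rfl)

theorem step_clearCols_cons :
    step S.program (cfg .clearCols q none inp dn R (c :: C) C' N) =
      some (cfg .clearCols q none inp dn R C C' N) :=
    congrArg some (cfg_ext rfl rfl fun k => by cases k <;> rfl)

theorem step_clearCols_nil (h : S.answer (S.passEnd q) = none) :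
    step S.program (cfg .clearCols q none inp dn R [] C' N) =
      some (cfg .rebuild (S.passEnd q) none inp dn R [] C' N) := by
  refine congrArg some (cfg_ext ?_ rfl fun k => by cases k <;> rfl)
  exact congrArg (fun o : Option Bool => some (cond o.isSome Label.clearRows Label.rebuild)) h

theorem step_clearCols_nil_of_answer (h : S.answer (S.passEnd q) = some b) :
    step S.program (cfg .clearCols q none inp dn R [] C' N) =
      some (cfg .clearRows (S.passEnd q) none inp dn R [] C' N) := by
  refine congrArg some (cfg_ext ?_ rfl fun k => by cases k <;> rfl)
  exact congrArg (fun o : Option Bool => some (cond o.isSome Label.clearRows Label.rebuild)) h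

theorem step_rebuild_cons :
    step S.program (cfg .rebuild q none inp dn R C C' (c :: N)) =
      some (cfg .rebuild q none inp dn (c :: R) (c :: C) C' N) :=
    congrArg some (cfg_ext rfl rfl fun k => by cases k <;> rfl)

theorem step_rebuild_nil :
    step S.program (cfg .rebuild q none inp dn R C C' []) =
      some (cfg .rewind q none inp dn R C C' []) :=
    congrArg some (cfg_ext rfl rfl fun k => by cases k <;> rfl)

theorem step_clearRows_cons :
    step S.program (cfg .clearRows q none inp dn R C C' (c :: N)) =
      some (cfg .clearRows q none inp dn R C C' N) :=
    congrArg some (cfg_ext rfl rfl fun k => by cases k <;> rfl)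

theorem step_clearRows_nil :
    step S.program (cfg .clearRows q none inp dn R C C' []) =
      some (cfg .clearInput q none inp dn R C C' []) :=
    congrArg some (cfg_ext rfl rfl fun k => by cases k <;> rfl)

theorem step_clearInput_cons :
    step S.program (cfg .clearInput q none inp (s :: dn) R C C' N) =
      some (cfg .clearInput q none inp dn R C C' N) :=
    congrArg some (cfg_ext rfl rfl fun k => by cases k <;> rfl)

theorem step_clearInput_nil (h : S.answer q = some b) :
    step S.program (cfg .clearInput q none [] [] [] [] [] []) = some (S.finalCfg b) := by
  refine congrArg some (cfg_ext rfl rfl fun k => ?_)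
  cases k
  case output => exact congrArg (fun o : Option Bool => [o.getD false]) h
  all_goals rfl

end Steps

section Runs

variable (q : Q) (a : L) (b : Bool) (inp dn : List (Option Bool)) (R C C' N : List L)

theorem run_init (r : List Bool) :
    ReachesIn (step S.program) (cfg .init q none (r.map some ++ inp) dn R C C' N)
      (cfg .init q none inp ((r.map some).reverse ++ dn) (List.replicate r.length S.blank ++ R)
        (List.replicate r.length S.blank ++ C) C' N) r.length := by
  induction r generalizing dn R C with
  | nil => exact .refl _
  | cons b r ih =>
    refine .head (S.step_init_some ..) ?_
    simpa [List.replicate_succ', List.append_assoc] using ih (some b :: dn) (S.blank :: R)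
      (S.blank :: C)

theorem run_rewind :
    ReachesIn (step S.program) (cfg .rewind q none inp dn R C C' N)
      (cfg .rowStart q none (dn.reverse ++ inp) [] R C C' N) (dn.length + 1) := by
  induction dn generalizing inp with
  | nil => exact .single (S.step_rewind_nil ..)
  | cons s dn ih => simpa using ReachesIn.head (S.step_rewind_cons ..) (ih (s :: inp))

theorem run_entry (r : List Bool) (h : r.length = C.length) :
    ReachesIn (step S.program) (cfg .entry q (some a) (r.map some ++ inp) dn R C C' N)
      (cfg .entry (S.readRow a q r C) (some a) inp ((r.map some).reverse ++ dn) R []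
        (C.reverse ++ C') N) r.length := by
  induction r generalizing q dn C C' with
  | nil =>
    obtain rfl : C = [] := by simpa using h.symm
    exact .refl _
  | cons b r ih =>
    cases C with
    | nil => simp at h
    | cons c C =>
      refine .head (S.step_entry_some ..) ?_
      simpa [readRow] using ih (S.entry q a c b) (some b :: dn) C (c :: C') (by simpa using h)

theorem run_rewindCols :
    ReachesIn (step S.program) (cfg .rewindCols q none inp dn R C C' N)
      (cfg .rowStart q none inp dn R (C'.reverse ++ C) [] N) (C'.length + 1) := by
  induction C' generalizing C with
  | nil => exact .single (S.step_rewindCols_nil ..)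
  | cons s C' ih => simpa using ReachesIn.head (S.step_rewindCols_cons ..) (ih (s :: C))

theorem run_row (r : List Bool) (h : r.length = C.length) :
    ReachesIn (step S.program)
      (cfg .rowStart q none (r.map some ++ none :: inp) dn (a :: R) C [] N)
      (cfg .rowStart (S.rowEnd (S.readRow a q r C) a).1 none inp
        ((r.map some ++ [none]).reverse ++ dn) R C []
        ((S.rowEnd (S.readRow a q r C) a).2 :: N)) (2 * C.length + 3) := by
  have h₁ := (S.run_entry q a (none :: inp) dn R C [] N r h).trans
    (.single (S.step_entry_none ..))
  have h₂ := (ReachesIn.single (S.step_rowStart_cons q a _ dn R C [] N)).trans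
    (h₁.trans (S.run_rewindCols ..))
  simp only [List.append_nil, List.reverse_reverse, List.length_reverse, h] at h₂
  convert h₂ using 1
  · simp
  · ring

/-- Each row moves the column labels to `colsDone` and back. New row labels go to `newRows`, so the
columns keep their old labels throughout the pass. -/
theorem run_rows (rows : List (List Bool)) (hr : ∀ r ∈ rows, r.length = C.length)
    (hR : R.length = rows.length) :
    ReachesIn (step S.program)
      (cfg .rowStart q none (encodeRows rows) dn R C [] N)
      (cfg .clearCols (S.readRows C q rows R).1 none []
        ((encodeRows rows).reverse ++ dn) [] C []
        ((S.readRows C q rows R).2.reverse ++ N)) (rows.length * (2 * C.length + 3) + 1) := by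
  induction rows generalizing q dn R N with
  | nil =>
    obtain rfl : R = [] := by simpa using hR
    simpa [readRows, encodeRows] using ReachesIn.single (S.step_rowStart_nil ..)
  | cons r rows ih =>
    cases R with
    | nil => simp at hR
    | cons a R =>
      have h₁ := S.run_row q a (encodeRows rows) dn R C N r
        (hr r (by simp))
      have h₂ := h₁.trans (ih _ _ R _ (fun r h => hr r (by simp [h])) (by simpa using hR))
      simp only [readRows, List.length_cons]
      convert h₂ using 1
      · simp [encodeRows]
      · simp [encodeRows]
      · ring

theorem run_clearCols (h : S.answer (S.passEnd q) = none) :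
    ReachesIn (step S.program) (cfg .clearCols q none inp dn R C C' N)
      (cfg .rebuild (S.passEnd q) none inp dn R [] C' N) (C.length + 1) := by
  induction C with
  | nil => exact .single (S.step_clearCols_nil (h := h) ..)
  | cons c C ih => exact .head (S.step_clearCols_cons ..) ih

theorem run_clearCols_of_answer (h : S.answer (S.passEnd q) = some b) :
    ReachesIn (step S.program) (cfg .clearCols q none inp dn R C C' N)
      (cfg .clearRows (S.passEnd q) none inp dn R [] C' N) (C.length + 1) := by
  induction C with
  | nil => exact .single (S.step_clearCols_nil_of_answer (h := h) ..)
  | cons c C ih => exact .head (S.step_clearCols_cons ..) ih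

theorem run_rebuild :
    ReachesIn (step S.program) (cfg .rebuild q none inp dn R C C' N)
      (cfg .rewind q none inp dn (N.reverse ++ R) (N.reverse ++ C) C' []) (N.length + 1) := by
  induction N generalizing R C with
  | nil => exact .single (S.step_rebuild_nil ..)
  | cons c N ih => simpa using ReachesIn.head (S.step_rebuild_cons ..) (ih (c :: R) (c :: C))

theorem run_clearRows :
    ReachesIn (step S.program) (cfg .clearRows q none inp dn R C C' N)
      (cfg .clearInput q none inp dn R C C' []) (N.length + 1) := by
  induction N with
  | nil => exact .single (S.step_clearRows_nil ..)
  | cons c N ih => exact .head (S.step_clearRows_cons ..) ih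

theorem run_clearInput (h : S.answer q = some b) :
    ReachesIn (step S.program) (cfg .clearInput q none [] dn [] [] [] [])
      (S.finalCfg b) (dn.length + 1) := by
  induction dn with
  | nil => exact .single (S.step_clearInput_nil (h := h) ..)
  | cons c N ih => exact .head (S.step_clearInput_cons ..) ih

end Runs

theorem length_readRows (cols : List L) (q : Q) (rows : List (List Bool)) (R : List L)
    (h : R.length = rows.length) : (S.readRows cols q rows R).2.length = R.length := by
  induction rows generalizing q R with
  | nil =>
    obtain rfl : R = [] := by simpa using h
    rfl
  | cons r rows ih =>
    cases R with
    | nil => simp at h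
    | cons a R => simp [readRows, ih _ R (by simpa using h)]

theorem length_encodeRows {rows : List (List Bool)} {n : ℕ} (hr : ∀ r ∈ rows, r.length = n) :
    (encodeRows rows).length = rows.length * (n + 1) := by
  induction rows with
  | nil => simp [encodeRows]
  | cons r rows ih =>
    have := ih fun r h => hr r (by simp [h])
    have h₁ := hr r (by simp)
    simp only [encodeRows, List.flatMap_cons, List.length_append] at this ⊢
    rw [this]
    simp [h₁]
    ring

section Passes

variable {rows : List (List Bool)} {n : ℕ}

/-- The configuration at the start of a pass. -/
def passCfg (rows : List (List Bool)) (x : Q × List L) :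
    Cfg (Alphabet L) Label (Vars L Q) :=
  cfg .rowStart x.1 none (encodeRows rows) [] x.2 x.2 [] []

theorem run_scan (hr : ∀ r ∈ rows, r.length = n) (hn : rows.length = n) {q : Q} {R : List L}
    (hR : R.length = n) :
    ReachesIn (step S.program) (passCfg rows (q, R))
      (cfg .clearCols (S.readRows R q rows R).1 none [] (encodeRows rows).reverse [] R []
        (S.readRows R q rows R).2.reverse)
      (n * (2 * n + 3) + 1) := by
  simpa [passCfg, hR, hn] using S.run_rows q [] R R [] rows (by simpa [hR] using hr) (by rw [hR, hn])

theorem length_pass (hn : rows.length = n) {x : Q × List L} (hx : x.2.length = n) :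
    (S.pass rows x).2.length = n := by
  have := S.length_readRows x.2 x.1 rows x.2 (hx.trans hn.symm)
  exact this.trans hx

/-- The scan takes n(2n + 3) + 1 steps, clearing the columns and rebuilding the labels n + 1 each,
and rewinding the input n(n + 1) + 1. -/
theorem run_pass (hr : ∀ r ∈ rows, r.length = n) (hn : rows.length = n) {x y : Q × List L}
    (hx : x.2.length = n) (hxy : S.passStep rows x = some y) :
    ReachesIn (step S.program) (passCfg rows x) (passCfg rows y) (3 * n ^ 2 + 6 * n + 4) := by
  obtain ⟨q, R⟩ := x
  unfold passStep at hxy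
  split_ifs at hxy with h
  obtain rfl : S.pass rows (q, R) = y := by simpa using hxy
  have h₁ := (((S.run_scan hr hn (q := q) hx).trans (S.run_clearCols (h := h) ..)).trans
    (S.run_rebuild ..)).trans (S.run_rewind ..)
  have hl : (S.readRows R q rows R).2.length = n := S.length_pass hn hx
  simp only at hx
  simp only [List.reverse_reverse, List.append_nil, List.length_reverse, hl, hx,
    length_encodeRows hr, hn] at h₁
  exact (congrArg _ (by ring)).mp h₁

theorem run_last (hr : ∀ r ∈ rows, r.length = n) (hn : rows.length = n) {x : Q × List L}
    (hx : x.2.length = n) {b : Bool} (h : S.answer (S.pass rows x).1 = some b) :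
    ReachesIn (step S.program) (passCfg rows x) (S.finalCfg b)
      (3 * n ^ 2 + 6 * n + 4) := by
  obtain ⟨q, R⟩ := x
  have h₁ := (((S.run_scan hr hn (q := q) hx).trans (S.run_clearCols_of_answer (h := h) ..)).trans
    (S.run_clearRows ..)).trans (S.run_clearInput (h := h) ..)
  have hl : (S.readRows R q rows R).2.length = n := S.length_pass hn hx
  simp only at hx
  simp only [List.length_reverse, hl, hx, length_encodeRows hr, hn] at h₁
  exact (congrArg _ (by ring)).mp h₁

theorem run_passes (hr : ∀ r ∈ rows, r.length = n) (hn : rows.length = n) {t : ℕ}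
    {x y : Q × List L} (hx : x.2.length = n) (hxy : ReachesIn (S.passStep rows) x y t) :
    ReachesIn (step S.program) (passCfg rows x) (passCfg rows y) (t * (3 * n ^ 2 + 6 * n + 4)) ∧
      y.2.length = n := by
  induction t generalizing x with
  | zero =>
    obtain rfl : x = y := by simpa [ReachesIn] using hxy
    simpa [hx] using ReachesIn.refl _
  | succ t ih =>
    obtain ⟨z, hxz, hzy⟩ := hxy.exists_head
    have hz : z.2.length = n := by
      unfold passStep at hxz
      split_ifs at hxz
      obtain rfl : S.pass rows x = z := by simpa using hxz
      exact S.length_pass hn hx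
    obtain ⟨h₁, h₂⟩ := ih hz hzy
    refine ⟨?_, h₂⟩
    have := (S.run_pass hr hn hx hxz).trans h₁
    exact (congrArg _ (by ring)).mp this

theorem run_start (hr : ∀ r ∈ rows, r.length = n) (hn : rows.length = n) :
    ∃ t ≤ 2 * n + 3, ReachesIn (step S.program)
      (cfg .init S.start none (encodeRows rows) [] [] [] [] [])
      (passCfg rows (S.start, List.replicate n S.blank)) t := by
  cases rows with
  | nil =>
    obtain rfl : n = 0 := by simpa using hn.symm
    exact ⟨_, by simp, .head (S.step_init_nil ..) (S.run_rewind ..)⟩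
  | cons r rows =>
    obtain rfl : r.length = n := hr r (by simp)
    have h₁ := ((S.run_init S.start (none :: encodeRows rows) [] [] [] [] [] r).trans
      (.single (S.step_init_none ..))).trans (S.run_rewind ..)
    refine ⟨2 * r.length + 3, le_rfl, ?_⟩
    convert h₁ using 1
    · simp [encodeRows]
    · simp [encodeRows, passCfg]
    · simp; ring

end Passes

/-! ### Scanners as polynomial-time Turing machines -/

/-- The Turing machine of a scanner. -/
def machine [Fintype L] [Fintype Q] : Turing.FinTM2 where
  K := Stack
  k₀ := .input
  k₁ := .output
  Γ := Alphabet L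
  Λ := Label
  main := .init
  σ := Vars L Q
  initialState := (S.start, none, none, none)
  Γk₀Fin := inferInstanceAs (Fintype (Option Bool))
  m := S.program

theorem initList_machine [Fintype L] [Fintype Q] (w : List (Option Bool)) :
    Turing.initList S.machine w = cfg .init S.start none w [] [] [] [] [] :=
  cfg_ext rfl rfl fun k => by cases k <;> rfl

theorem haltList_machine [Fintype L] [Fintype Q] (b : Bool) :
    Turing.haltList S.machine [b] = S.finalCfg b :=
  cfg_ext rfl rfl fun k => by cases k <;> rfl

/-- A problem about Boolean square matrices is solved in polynomial time if a scanner solves it with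
a polynomial number of passes. -/
theorem decidableInPolyTime [Finite L] [Finite Q] {α : Type} {enc : α → List (Option Bool)}
    {P : α → Prop} (size : α → ℕ) (mat : α → List (List Bool))
    (hrow : ∀ a, ∀ r ∈ mat a, r.length = size a) (hmat : ∀ a, (mat a).length = size a)
    (henc : ∀ a, enc a = encodeRows (mat a)) (c e : ℕ)
    (hrun : ∀ a, ∃ t ≤ c * (size a + 1) ^ e, ∃ x,
      ReachesIn (S.passStep (mat a)) (S.start, List.replicate (size a) S.blank) x t ∧
      ∃ b, S.answer (S.pass (mat a) x).1 = some b ∧ (b = true ↔ P a)) :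
    DecidableInPolyTime enc P := by
  classical
  have := Fintype.ofFinite L
  have := Fintype.ofFinite Q
  refine ⟨{ tm := S.machine
            inputAlphabet := Equiv.refl (Option Bool)
            outputAlphabet := Equiv.refl Bool
            -- The passes, including the last one, take at most 6(n + 1)² steps each, and the start
            -- takes at most 3(n + 1); n is at most the input length.
            time := (Polynomial.C c * (Polynomial.X + 1) ^ e + 1) *
              (6 * (Polynomial.X + 1) ^ 2) + 3 * (Polynomial.X + 1)
            outputsFun := fun a => Classical.choice ?_ }, fun k => ?_⟩
  · obtain ⟨t, ht, x, hx, b, hb, hP⟩ := hrun a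
    obtain ⟨t₀, ht₀, h₀⟩ := S.run_start (hrow a) (hmat a)
    obtain ⟨h₁, hl⟩ := S.run_passes (hrow a) (hmat a) (by simp) hx
    have h₂ := (h₀.trans h₁).trans (S.run_last (hrow a) (hmat a) hl hb)
    obtain rfl : b = decide (P a) := by
      rw [Bool.eq_iff_iff, hP, decide_eq_true_iff]
    have hlen : size a ≤ (enc a).length := by
      rw [henc, length_encodeRows (hrow a), hmat]
      exact Nat.le_mul_of_pos_right _ (by omega)
    refine ⟨⟨⟨t₀ + t * (3 * size a ^ 2 + 6 * size a + 4) + (3 * size a ^ 2 + 6 * size a + 4),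
      ?_⟩, ?_⟩⟩
    · have e₁ : List.map (Equiv.refl (Option Bool)).invFun (enc a) = encodeRows (mat a) := by
        rw [henc]; exact List.map_id _
      have e₂ : (Option.map (Turing.haltList S.machine)
          (some (List.map (Equiv.refl Bool).invFun (Computability.encodeBool (decide (P a)))))) =
            some (S.finalCfg (decide (P a))) :=
        congrArg some (S.haltList_machine _)
      erw [e₁, e₂, initList_machine]
      exact h₂
    · have hq : 3 * size a ^ 2 + 6 * size a + 4 ≤ 6 * (size a + 1) ^ 2 := by nlinarith
      simp only [Polynomial.eval_add, Polynomial.eval_mul, Polynomial.eval_pow, Polynomial.eval_X,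
        Polynomial.eval_C, Polynomial.eval_one, Polynomial.eval_ofNat]
      calc _ = (t + 1) * (3 * size a ^ 2 + 6 * size a + 4) + t₀ := by ring
        _ ≤ (c * (size a + 1) ^ e + 1) * (6 * (size a + 1) ^ 2) + 3 * (size a + 1) := by
          gcongr; omega
        _ ≤ _ := by gcongr
  · cases k
    case output => exact inferInstanceAs (Finite Bool)
    case input | done => exact inferInstanceAs (Finite (Option Bool))
    all_goals exact inferInstanceAs (Finite L)

end Scanner

/-! ### Enumerating the placements of finitely many marks -/

namespace Marks

/-- Sets of marks. -/
abbrev Lab (k : ℕ) : Type := Finset (Fin (k + 1))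

/-- The pairs of labels of matrix entries, together with the value of the entry. -/
abbrev Code (k : ℕ) : Type := Finset (Lab k × Lab k × Bool)

/-- The state of the enumeration. -/
@[ext] structure State (k : ℕ) : Type where
  /-- the codes of the earlier placements -/
  acc : Finset (Code k)
  /-- the part of the code of the current placement that was seen in this pass -/
  seen : Code k
  /-- the mark that moves in this pass -/
  mark : Fin (k + 1)
  /-- the moving mark is currently held -/
  hold : Bool
  /-- the marks that are placed -/
  placed : Lab k

instance (k : ℕ) : Finite (State k) :=
  Finite.of_injective (fun s => (s.acc, s.seen, s.mark, s.hold, s.placed)) fun s t h => by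
    simp only [Prod.mk.injEq] at h
    exact State.ext h.1 h.2.1 h.2.2.1 h.2.2.2.1 h.2.2.2.2

/-- The scanner that computes the codes of all placements of the marks `0, …, k - 1`. -/
def scanner {k : ℕ} (F : Finset (Code k) → Bool) : Scanner (Lab k) (State k) where
  entry s a c b := { s with seen := insert (a, c, b) s.seen }
  rowEnd s a :=
    -- A held mark is put down on this row. A moving mark found here is picked up and put down at
    -- the end of the next row.
    if s.hold = true then ({ s with hold := false }, insert s.mark a)
    else if s.mark ∈ a then ({ s with hold := true }, a.erase s.mark) else (s, a)
  passEnd s :=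
    -- A mark still held has left the last row: it becomes absent and the next mark moves, as in a
    -- carry. Otherwise mark 0 moves again. `placed` shows whether the next moving mark is absent,
    -- hence held from the start.
    let placed := if s.hold = true then s.placed.erase s.mark else insert s.mark s.placed
    let mark := if s.hold = true then s.mark + 1 else 0
    { acc := insert s.seen s.acc, seen := ∅, mark := mark, hold := decide (mark ∉ placed),
      placed := placed }
  -- Mark k is never placed; its turn signals that the odometer has run through.
  answer s := if s.mark = Fin.last k then some (F s.acc) else none
  blank := ∅
  start := { acc := ∅, seen := ∅, mark := 0, hold := true, placed := ∅ }

/-! ### Placements, their codes, and the effect of one pass -/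

variable {k : ℕ} (F : Finset (Code k) → Bool) (A : ℕ → ℕ → Bool) (n : ℕ)
  (p : Fin (k + 1) → ℕ)

/-- The marks at position `v`. -/
def label (v : ℕ) : Lab k := Finset.univ.filter fun i => p i = v

/-- The matrix as a list of rows. -/
def matrix : List (List Bool) := (List.range n).map fun u => (List.range n).map (A u)

/-- The labels of all rows. -/
def labels : List (Lab k) := (List.range n).map (label p)

/-- The code of a placement. -/
def code : Code k :=
  ((List.range n).flatMap fun u =>
    (List.range n).map fun v => (label p u, label p v, A u v)).toFinset

/-- The cyclic successor of a position, where `n` stands for an absent mark. -/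
def next (c : ℕ) : ℕ := if c = n then 0 else c + 1

/-- The state at the start of the pass that moves the mark `m`. -/
def state (acc : Finset (Code k)) (m : Fin (k + 1)) : State k where
  acc := acc
  seen := ∅
  mark := m
  hold := decide (p m = n)
  placed := Finset.univ.filter fun i => p i ≠ n

theorem readRow_eq (a : Lab k) (s : State k) (l : List ℕ) (f : ℕ → Bool) (g : ℕ → Lab k) :
    (scanner F).readRow a s (l.map f) (l.map g) =
      { s with seen := s.seen ∪ (l.map fun v => (a, g v, f v)).toFinset } := by
  induction l generalizing s with
  | nil => simp [Scanner.readRow]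
  | cons v l ih =>
    simp only [List.map_cons, Scanner.readRow, ih]
    ext <;> simp [scanner]

variable {n p}

/-- The invariant is that the mark is held at the end of row u exactly if u is its new position. -/
theorem rowEnd_eq (s : State k) (hp : ∀ i, p i ≤ n) {u : ℕ} (hu : u < n)
    (hs : s.hold = decide (next n (p s.mark) = u)) :
    (scanner F).rowEnd s (label p u) =
      ({ s with hold := decide (next n (p s.mark) = u + 1) },
        label (Function.update p s.mark (next n (p s.mark))) u) := by
  have hm := hp s.mark
  have hlab : label (Function.update p s.mark (next n (p s.mark))) u =
      if next n (p s.mark) = u then insert s.mark (label p u) else (label p u).erase s.mark := by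
    ext i
    by_cases hi : i = s.mark
    · subst hi
      split_ifs with h <;> simp [label, h]
    · split_ifs with h <;> simp [label, hi]
  rw [hlab]
  by_cases h : next n (p s.mark) = u
  · have : ¬ next n (p s.mark) = u + 1 := by omega
    simp [scanner, hs, h]
  · by_cases h' : s.mark ∈ label p u
    · have hpu : p s.mark = u := by simpa [label] using h'
      have : next n (p s.mark) = u + 1 := by simp [next, hpu, hu.ne]
      simp [scanner, hs, h', this]
    · have hpu : p s.mark ≠ u := by simpa [label] using h'
      have : ¬ next n (p s.mark) = u + 1 := by
        by_cases e : p s.mark = n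
        · simp [next, e]
        · simpa [next, e] using hpu
      have hh : s.hold = false := by simp [hs, h]
      simp [scanner, h, h', this, hh]
      exact State.ext rfl rfl rfl hh rfl

theorem readRows_eq (s : State k) (hp : ∀ i, p i ≤ n) {u d : ℕ} (hu : u + d = n)
    (hs : s.hold = decide (next n (p s.mark) = u)) :
    (scanner F).readRows (labels n p) s
        ((List.range' u d).map fun u => (List.range n).map (A u)) ((List.range' u d).map (label p)) =
      ({ s with
          seen := s.seen ∪ ((List.range' u d).flatMap fun u =>
            (List.range n).map fun v => (label p u, label p v, A u v)).toFinset
          hold := decide (next n (p s.mark) = n) },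
        (List.range' u d).map (label (Function.update p s.mark (next n (p s.mark))))) := by
  induction d generalizing u s with
  | zero =>
    obtain rfl : u = n := by omega
    simp [Scanner.readRows, ← hs]
  | succ d ih =>
    simp only [List.range'_succ, List.map_cons, Scanner.readRows, labels]
    rw [readRow_eq, rowEnd_eq F _ hp (by omega) (by exact hs)]
    simp only
    rw [← labels, ih _ (by omega) rfl]
    simp [Finset.union_assoc]

/-- The recorded code is that of the placement before the move, since new labels take effect only in
the next pass. -/
theorem pass_eq (acc : Finset (Code k)) (m : Fin (k + 1)) (hp : ∀ i, p i ≤ n) :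
    (scanner F).pass (matrix A n) (state n p acc m, labels n p) =
      (state n (Function.update p m (next n (p m))) (insert (code A n p) acc)
          (if next n (p m) = n then m + 1 else 0),
        labels n (Function.update p m (next n (p m)))) := by
  have h := readRows_eq F A (state n p acc m) hp (u := 0) (d := n) (by simp)
    (by simp only [state, next]; congr 1; split_ifs with h <;> simp [h])
  simp only [← List.range_eq_range'] at h
  simp only [Scanner.pass, matrix]
  rw [← labels] at h
  rw [h]
  refine Prod.ext ?_ rfl
  have hpl : (if next n (p m) = n then (Finset.univ.filter fun i => p i ≠ n).erase m else
      insert m (Finset.univ.filter fun i => p i ≠ n)) =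
        Finset.univ.filter fun i => Function.update p m (next n (p m)) i ≠ n := by
    ext i
    by_cases hi : i = m
    · subst hi
      split_ifs with h <;> simp [h]
    · split_ifs with h <;> simp [hi]
  by_cases h : next n (p m) = n
  · simp only [h, if_true] at hpl
    refine State.ext ?_ rfl ?_ ?_ ?_ <;> simp [scanner, state, code, h, hpl]
  · simp only [h, if_false] at hpl
    refine State.ext ?_ rfl ?_ ?_ ?_ <;> simp [scanner, state, code, h, hpl]

/-! ### The odometer visits all placements -/

/-- The codes of all placements. -/
def codes (k : ℕ) (A : ℕ → ℕ → Bool) (n : ℕ) : Set (Code k) :=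
  {x | ∃ p : Fin (k + 1) → ℕ, (∀ i, p i ≤ n) ∧ p (Fin.last k) = n ∧ code A n p = x}

theorem passStep_eq (acc : Finset (Code k)) (m : Fin (k + 1)) (hp : ∀ i, p i ≤ n)
    (hm : (if next n (p m) = n then m + 1 else 0) ≠ Fin.last k) :
    (scanner F).passStep (matrix A n) (state n p acc m, labels n p) =
      some (state n (Function.update p m (next n (p m))) (insert (code A n p) acc)
          (if next n (p m) = n then m + 1 else 0),
        labels n (Function.update p m (next n (p m)))) := by
  rw [Scanner.passStep, pass_eq F A acc m hp, if_pos]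
  simp [scanner, state, hm]

/-- The placement with mark `j` at the position that it has after `e` moves. -/
def moved (n : ℕ) (p : Fin (k + 1) → ℕ) (j : Fin (k + 1)) (e : ℕ) : Fin (k + 1) → ℕ :=
  Function.update p j (if e = 0 then n else e - 1)

/-- From `p` with the accumulated codes `acc`, the moves of the marks before `j` lead in `t` passes
to the same placement with the accumulated codes `acc'`, and mark `j` is the next to move. -/
def Sweep (F : Finset (Code k) → Bool) (A : ℕ → ℕ → Bool) (n : ℕ) (p : Fin (k + 1) → ℕ)
    (acc acc' : Finset (Code k)) (j : Fin (k + 1)) (t : ℕ) : Prop :=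
  ReachesIn ((scanner F).passStep (matrix A n)) (state n p acc 0, labels n p)
    (state n p acc' j, labels n p) t ∧
  acc ⊆ acc' ∧ (↑acc ⊆ codes k A n → ↑acc' ⊆ codes k A n) ∧
  ∀ p' : Fin (k + 1) → ℕ, (∀ i, p' i ≤ n) → (∀ i, j ≤ i → p' i = p i) →
    code A n p' ∈ insert (code A n p) acc'

/-- The e moves of mark j cost one pass each, and e + 1 sweeps of the lower marks surround them. The
current placement is recorded only by the next pass, hence the `insert` in the conclusion. -/
theorem exists_sweep_moved {j : Fin (k + 1)} (hj : j < Fin.last k) (hp : ∀ i, p i ≤ n)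
    (hpj : ∀ i ≤ j, p i = n) (hlast : p (Fin.last k) = n) {T : ℕ}
    (ih : ∀ p : Fin (k + 1) → ℕ, (∀ i, p i ≤ n) → (∀ i < j, p i = n) → p (Fin.last k) = n →
      ∀ acc, ∃ t ≤ T, ∃ acc', Sweep F A n p acc acc' j t)
    (acc : Finset (Code k)) (e : ℕ) (he : e ≤ n) :
    ∃ t ≤ e * (T + 1) + T, ∃ acc',
      ReachesIn ((scanner F).passStep (matrix A n)) (state n p acc 0, labels n p)
        (state n (moved n p j e) acc' j, labels n (moved n p j e)) t ∧
      acc ⊆ acc' ∧ (↑acc ⊆ codes k A n → ↑acc' ⊆ codes k A n) ∧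
      ∀ p' : Fin (k + 1) → ℕ, (∀ i, p' i ≤ n) → (∀ i, j < i → p' i = p i) →
        (∃ e' ≤ e, p' j = if e' = 0 then n else e' - 1) →
        code A n p' ∈ insert (code A n (moved n p j e)) acc' := by
  have hmp : ∀ e ≤ n, ∀ i, moved n p j e i ≤ n := fun e he i => by
    by_cases hi : i = j
    · subst hi; simp only [moved, Function.update_self]; split_ifs <;> omega
    · simpa [moved, hi] using hp i
  have hmj : ∀ e, ∀ i < j, moved n p j e i = n := fun e i hi => by
    simp [moved, hi.ne, hpj i hi.le]
  have hml : ∀ e, moved n p j e (Fin.last k) = n := fun e => by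
    simp [moved, hj.ne', hlast]
  induction e with
  | zero =>
    have h0 : moved n p j 0 = p := by simp [moved, ← hpj j le_rfl]
    obtain ⟨t, ht, acc', h₁, h₂, h₃, h₄⟩ := ih p hp (fun i hi => hpj i hi.le) hlast acc
    refine ⟨t, by omega, acc', by rwa [h0], h₂, h₃, ?_⟩
    rintro p' hp' hi ⟨e', he', hj'⟩
    rw [h0]
    refine h₄ p' hp' fun i hji => ?_
    rcases hji.eq_or_lt with rfl | h
    · rw [hj', hpj _ le_rfl, if_pos (by omega)]
    · exact hi i h
  | succ e ihe =>
    obtain ⟨t, ht, acc₁, h₁, h₂, h₃, h₄⟩ := ihe (by omega)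
    have hnext : next n (moved n p j e j) = e := by
      simp only [next, moved, Function.update_self]
      split_ifs <;> omega
    have hstep := passStep_eq F A acc₁ j (hmp e (by omega)) (by
      rw [hnext, if_neg (by omega)]
      exact (lt_of_le_of_lt (Fin.zero_le j) hj).ne)
    rw [hnext, if_neg (by omega)] at hstep
    have hm : Function.update (moved n p j e) j e = moved n p j (e + 1) := by simp [moved]
    rw [hm] at hstep
    obtain ⟨t', ht', acc', g₁, g₂, g₃, g₄⟩ := ih (moved n p j (e + 1)) (hmp _ he) (hmj _) (hml _)
      (insert (code A n (moved n p j e)) acc₁)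
    refine ⟨t + (t' + 1), by nlinarith, acc', h₁.trans (.head hstep g₁),
      h₂.trans ((Finset.subset_insert _ _).trans g₂), fun h => g₃ ?_, ?_⟩
    · rw [Finset.coe_insert, Set.insert_subset_iff]
      exact ⟨⟨_, hmp e (by omega), hml e, rfl⟩, h₃ h⟩
    · rintro p' hp' hi ⟨e', he', hj'⟩
      rcases he'.eq_or_lt with rfl | hlt
      · refine g₄ p' hp' fun i hji => ?_
        rcases hji.eq_or_lt with rfl | h
        · simp [hj', moved]
        · simpa [moved, h.ne'] using hi i h
      · exact Finset.mem_insert_of_mem (g₂ (h₄ p' hp' hi ⟨e', by omega, hj'⟩))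

theorem next_moved (n : ℕ) (p : Fin (k + 1) → ℕ) (j : Fin (k + 1)) :
    next n (moved n p j n j) = n := by
  simp only [next, moved, Function.update_self]
  split_ifs <;> omega

theorem moved_le (hp : ∀ i, p i ≤ n) (j i : Fin (k + 1)) : moved n p j n i ≤ n := by
  by_cases hi : i = j
  · subst hi; simp only [moved, Function.update_self]; split_ifs <;> omega
  · simpa [moved, hi] using hp i

theorem exists_eq_moved {c : ℕ} (hc : c ≤ n) : ∃ e ≤ n, c = if e = 0 then n else e - 1 := by
  rcases hc.eq_or_lt with rfl | h
  · exact ⟨0, by simp, by simp⟩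
  · exact ⟨c + 1, h, by simp⟩

theorem exists_sweep (j : ℕ) (hj : j < k) (hp : ∀ i, p i ≤ n)
    (hpj : ∀ i < Fin.ofNat (k + 1) j, p i = n) (hlast : p (Fin.last k) = n)
    (acc : Finset (Code k)) :
    ∃ t ≤ (n + 2) ^ j - 1, ∃ acc', Sweep F A n p acc acc' (Fin.ofNat (k + 1) j) t := by
  induction j generalizing p acc with
  | zero =>
    refine ⟨0, by simp, acc, .refl _, subset_rfl, id, fun p' _ h => ?_⟩
    obtain rfl : p' = p := funext fun i => h i (Fin.zero_le i)
    simp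
  | succ j ih =>
    have hjv : (Fin.ofNat (k + 1) j).val = j := Nat.mod_eq_of_lt (by omega)
    have hjv' : (Fin.ofNat (k + 1) (j + 1)).val = j + 1 := Nat.mod_eq_of_lt (by omega)
    have hsucc : Fin.ofNat (k + 1) j + 1 = Fin.ofNat (k + 1) (j + 1) := by
      ext; rw [Fin.val_add_one_of_lt (by rw [Fin.lt_def, hjv, Fin.val_last]; omega), hjv, hjv']
    generalize hJ : Fin.ofNat (k + 1) j = J at *
    have hJl : J < Fin.last k := by rw [Fin.lt_def, hjv, Fin.val_last]; omega
    have hpJ : ∀ i ≤ J, p i = n := fun i hi => hpj i (by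
      rw [Fin.le_def] at hi; rw [Fin.lt_def]; omega)
    obtain ⟨t, ht, acc₁, h₁, h₂, h₃, h₄⟩ := exists_sweep_moved F A hJl hp hpJ hlast
      (fun p hp hpj hl acc => ih (by omega) hp hpj hl acc) acc n le_rfl
    have hstep := passStep_eq F A acc₁ J (moved_le hp J) (by
      rw [next_moved, if_pos rfl, hsucc, Ne, Fin.ext_iff, hjv', Fin.val_last]; omega)
    have hm : Function.update (moved n p J n) J n = p := by
      simp [moved, ← hpJ J le_rfl]
    rw [next_moved, if_pos rfl, hsucc, hm] at hstep
    refine ⟨t + 1, ?_, _, h₁.trans (.single hstep), h₂.trans (Finset.subset_insert _ _),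
      fun h => ?_, fun p' hp' hi => ?_⟩
    -- One more mark costs (n + 1)(T + 1) passes. As carries take passes of their own, the base is n
    -- + 2 rather than n + 1.
    · have hpos : 1 ≤ (n + 2) ^ j := Nat.one_le_pow _ _ (by omega)
      obtain ⟨T, hT⟩ := Nat.exists_eq_add_of_le hpos
      rw [hT] at ht
      rw [pow_succ, hT]
      have : t ≤ n * (T + 1) + T := by simpa using ht
      refine Nat.le_sub_one_of_lt ?_
      nlinarith
    · rw [Finset.coe_insert, Set.insert_subset_iff]
      exact ⟨⟨_, moved_le hp J, by simp [moved, hJl.ne', hlast], rfl⟩, h₃ h⟩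
    · refine Finset.mem_insert_of_mem (h₄ p' hp' (fun i hi' => hi i ?_) (exists_eq_moved (hp' J)))
      rw [Fin.lt_def] at hi'
      rw [Fin.le_def]; omega

/-- Mark k - 1 makes n moves with full sweeps in between; the pass that drops it off the end records
the last code and hands the turn to mark k. -/
theorem exists_codes (hk : 0 < k) :
    ∃ t ≤ (n + 2) ^ k, ∃ x,
      ReachesIn ((scanner F).passStep (matrix A n))
        ((scanner F).start, List.replicate n (scanner F).blank) x t ∧
      ∃ acc : Finset (Code k), ↑acc = codes k A n ∧
        (scanner F).answer ((scanner F).pass (matrix A n) x).1 = some (F acc) := by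
  obtain ⟨j, rfl⟩ : ∃ j, k = j + 1 := ⟨k - 1, by omega⟩
  have hjv : (Fin.ofNat (j + 1 + 1) j).val = j := Nat.mod_eq_of_lt (by omega)
  obtain ⟨J, hJ⟩ : ∃ J, Fin.ofNat (j + 1 + 1) j = J := ⟨_, rfl⟩
  have hsucc : J + 1 = Fin.last (j + 1) := by
    rw [← hJ]
    ext; rw [Fin.val_add_one_of_lt (by rw [Fin.lt_def, hjv, Fin.val_last]; omega), hjv,
      Fin.val_last]
  have hJl : J < Fin.last (j + 1) := by rw [← hJ, Fin.lt_def, hjv, Fin.val_last]; omega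
  have hp : ∀ i : Fin (j + 1 + 1), (fun _ => n : Fin (j + 1 + 1) → ℕ) i ≤ n := fun _ => le_rfl
  obtain ⟨t, ht, acc₁, h₁, h₂, h₃, h₄⟩ := exists_sweep_moved F A hJl hp (fun _ _ => rfl) rfl
    (fun p hp hpj hl acc => hJ ▸ exists_sweep F A j (by omega) hp (hJ ▸ hpj) hl acc) ∅ n le_rfl
  have hs : (state n (fun _ => n) ∅ 0, labels n fun _ => n) =
      ((scanner F).start, List.replicate n (scanner F).blank) := by
    refine Prod.ext (State.ext rfl rfl rfl ?_ ?_) ?_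
    · simp [state, scanner]
    · simp [state, scanner]
    · refine List.eq_replicate_iff.2 ⟨by simp [labels], fun a ha => ?_⟩
      obtain ⟨v, hv, rfl⟩ := List.mem_map.1 ha
      have : n ≠ v := (List.mem_range.1 hv).ne'
      simp [label, scanner, this]
  rw [hs] at h₁
  refine ⟨t, ?_, _, h₁, insert (code A n (moved n (fun _ => n) J n)) acc₁, ?_, ?_⟩
  · have hpos : 1 ≤ (n + 2) ^ j := Nat.one_le_pow _ _ (by omega)
    obtain ⟨T, hT⟩ := Nat.exists_eq_add_of_le hpos
    rw [hT] at ht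
    rw [pow_succ, hT]
    have : t ≤ n * (T + 1) + T := by simpa using ht
    nlinarith
  · apply subset_antisymm
    · rw [Finset.coe_insert, Set.insert_subset_iff]
      exact ⟨⟨_, moved_le hp J, by simp [moved, hJl.ne'], rfl⟩, h₃ (by simp)⟩
    · rintro _ ⟨p', hp', hl, rfl⟩
      refine h₄ p' hp' (fun i hi => ?_) (exists_eq_moved (hp' J))
      obtain rfl : i = Fin.last (j + 1) := by
        ext
        have := i.isLt
        rw [Fin.lt_def, ← hJ, hjv] at hi
        rw [Fin.val_last]; omega
      exact hl
  · rw [pass_eq F A acc₁ J (moved_le hp J), next_moved, if_pos rfl, hsucc]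
    simp only [scanner, state, if_true]

theorem mem_code {a b : Lab k} {c : Bool} :
    (a, b, c) ∈ code A n p ↔ ∃ u < n, ∃ v < n, label p u = a ∧ label p v = b ∧ A u v = c := by
  simp [code]

theorem label_injective {u v : ℕ} (h : (label p u).Nonempty) (huv : label p v = label p u) :
    v = u := by
  obtain ⟨i, hi⟩ := h
  have hi' := huv ▸ hi
  simp only [label, Finset.mem_filter, Finset.mem_univ, true_and] at hi hi'
  omega

end Marks

/-! ### Codes determine the local structure -/

/-- Every induced subgraph of `G` on at most `k` vertices is also an induced subgraph of `H`, in such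
a way that vertices without further neighbours are mapped to such vertices. -/
def LocallyEmbeds {V W : Type*} (k : ℕ) (G : SimpleGraph V) (H : SimpleGraph W) : Prop :=
  ∀ X : Finset V, X.card ≤ k → ∃ f : V → W, Set.InjOn f X ∧
    (∀ x ∈ X, ∀ y ∈ X, H.Adj (f x) (f y) ↔ G.Adj x y) ∧
    ∀ x ∈ X, (∀ y, G.Adj x y → y ∈ X) → ∀ w, H.Adj (f x) w → ∃ y ∈ X, f y = w

namespace Marks

open Classical in
/-- The adjacency matrix of a graph. -/
noncomputable def adj {n : ℕ} (G : SimpleGraph (Fin n)) (u v : ℕ) : Bool :=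
  decide (∃ (hu : u < n) (hv : v < n), G.Adj ⟨u, hu⟩ ⟨v, hv⟩)

theorem adj_eq_true {n : ℕ} (G : SimpleGraph (Fin n)) (u v : Fin n) :
    adj G u v = true ↔ G.Adj u v := by
  simp [adj]

/-- Mark the vertices of X and take a placement in H with the same code. Nonempty labels identify
vertices, so the code gives the adjacencies on X; entries with an empty label record edges leaving
X. -/
theorem locallyEmbeds {n n' k : ℕ} {G : SimpleGraph (Fin n)} {H : SimpleGraph (Fin n')}
    (h : codes k (adj G) n ⊆ codes k (adj H) n') : LocallyEmbeds k G H := by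
  intro X hX
  let p : Fin (k + 1) → ℕ := fun i =>
    if hi : (i : ℕ) < X.card then (X.equivFin.symm ⟨i, hi⟩ : Fin n) else n
  have hpX : ∀ x ∈ X, (label p x).Nonempty := fun x hx => by
    have hi := (X.equivFin ⟨x, hx⟩).isLt
    refine ⟨⟨X.equivFin ⟨x, hx⟩, by omega⟩, ?_⟩
    simp [label, p]
  obtain ⟨p', hp', -, hc⟩ := h ⟨p, fun i => by
      simp only [p]; split_ifs
      · exact (Fin.isLt _).le
      · exact le_rfl,
    dif_neg (by simpa using hX), rfl⟩
  have key : ∀ {a b : Lab k} {c : Bool}, (∃ u : Fin n, ∃ v : Fin n,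
      label p u = a ∧ label p v = b ∧ adj G u v = c) ↔ ∃ u : Fin n', ∃ v : Fin n',
      label p' u = a ∧ label p' v = b ∧ adj H u v = c := fun {a b c} => by
    have h₁ := mem_code (adj G) (n := n) (p := p) (a := a) (b := b) (c := c)
    have h₂ := mem_code (adj H) (n := n') (p := p') (a := a) (b := b) (c := c)
    rw [hc, h₁] at h₂
    simpa only [Fin.exists_iff, exists_prop] using h₂
  -- The diagonal entry at x shows that its label occurs in H, even for an unmarked x.
  have hf : ∀ x : Fin n, ∃ w : Fin n', label p' w = label p x := fun x => by
    obtain ⟨w, -, hw, -⟩ := key.1 ⟨x, x, rfl, rfl, rfl⟩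
    exact ⟨w, hw⟩
  choose f hf using hf
  have hinj : ∀ x ∈ X, ∀ y : Fin n, label p y = label p x → y = x := fun x hx y hy =>
    Fin.ext (label_injective (hpX x hx) hy)
  have hinj' : ∀ x ∈ X, ∀ w : Fin n', label p' w = label p x → w = f x := fun x hx w hw =>
    Fin.ext (label_injective (by rw [hf]; exact hpX x hx) (hw.trans (hf x).symm))
  refine ⟨f, fun x hx y hy hxy => ?_, fun x hx y hy => ?_, fun x hx hint w hw => ?_⟩
  · exact hinj y hy x (by rw [← hf, hxy, hf])
  · constructor
    · intro hH
      obtain ⟨u, v, hu, hv, huv⟩ := key.2 ⟨f x, f y, hf x, hf y, (adj_eq_true H _ _).2 hH⟩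
      rwa [hinj x hx u hu, hinj y hy v hv, adj_eq_true] at huv
    · intro hG
      obtain ⟨u, v, hu, hv, huv⟩ := key.1 ⟨x, y, rfl, rfl, (adj_eq_true G _ _).2 hG⟩
      rwa [hinj' x hx u hu, hinj' y hy v hv, adj_eq_true] at huv
  · obtain ⟨u, v, hu, hv, huv⟩ := key.2 ⟨f x, w, hf x, rfl, (adj_eq_true H _ _).2 hw⟩
    rw [hinj x hx u hu, adj_eq_true] at huv
    have hvX := hint v huv
    exact ⟨v, hvX, (hinj' v hvX w hv.symm).symm⟩

end Marks

/-- A property of graphs is decidable in polynomial time if it is determined by the induced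
subgraphs on at most `k` vertices, with the information which of their vertices have further
neighbours. -/
theorem decidableInPolyTime_of_locallyEmbeds {Q : FinGraph → Prop} {P : {G // Q G} → Prop} {k : ℕ}
    (hk : 0 < k)
    (hP : ∀ G H : {G // Q G}, LocallyEmbeds k G.1.graph H.1.graph →
      LocallyEmbeds k H.1.graph G.1.graph → P G → P H) :
    DecidableInPolyTime (fun G : {G // Q G} => G.val.encode) P := by
  classical
  -- This is a table on a finite type and becomes part of the machine; it need not be computed. By
  -- `hP`, any graph with the same codes gives the same answer.
  let F : Finset (Marks.Code k) → Bool := fun acc =>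
    decide (∃ G, P G ∧ (acc : Set (Marks.Code k)) = Marks.codes k (Marks.adj G.1.graph) G.1.n)
  have hmap : ∀ (n : ℕ) {β : Type} (f : Fin n → β) (g : ℕ → β), (∀ i : Fin n, g i = f i) →
      (List.finRange n).map f = (List.range n).map g := fun n β f g h => by
    refine List.ext_getElem (by simp) fun i h₁ h₂ => ?_
    have := h ⟨i, by simpa using h₁⟩
    simp [this]
  refine (Marks.scanner F).decidableInPolyTime (fun G => G.1.n)
    (fun G => Marks.matrix (Marks.adj G.1.graph) G.1.n) (fun G r hr => ?_) (fun G => ?_)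
    (fun G => ?_) (2 ^ k) k fun G => ?_
  · obtain ⟨u, -, rfl⟩ := List.mem_map.1 hr
    simp
  · simp [Marks.matrix]
  · rw [FinGraph.encode, Scanner.encodeRows, Marks.matrix, List.flatMap_map, List.flatMap_def,
      List.flatMap_def]
    refine congrArg List.flatten (hmap _ _ _ fun u => ?_)
    rw [List.map_map, ← hmap G.1.n (fun v => some (decide (G.1.graph.Adj u v)))]
    intro v
    simp [Marks.adj]
  · obtain ⟨t, ht, x, hx, acc, hacc, hans⟩ :=
      Marks.exists_codes F (Marks.adj G.1.graph) (n := G.1.n) hk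
    refine ⟨t, ht.trans ?_, x, hx, F acc, hans, ?_⟩
    · rw [← mul_pow]
      exact Nat.pow_le_pow_left (by omega) k
    · simp only [F, decide_eq_true_eq, hacc]
      constructor
      · rintro ⟨H, hH, h⟩
        exact hP H G (Marks.locallyEmbeds h.ge) (Marks.locallyEmbeds h.le) hH
      · exact fun h => ⟨G, h, rfl⟩


section Matchings

open scoped Classical

variable {V : Type} {G : SimpleGraph V} {S T M N : Finset (Sym2 V)}

/-! ### Matchings as sets of edges -/

/-- A set of pairwise disjoint edges. -/
def IsMat (G : SimpleGraph V) (S : Finset (Sym2 V)) : Prop :=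
  (∀ e ∈ S, e ∈ G.edgeSet) ∧ ∀ e ∈ S, ∀ f ∈ S, ∀ v, v ∈ e → v ∈ f → e = f

/-- A matching without edges of the graph between its members. -/
def IsInd (G : SimpleGraph V) (S : Finset (Sym2 V)) : Prop :=
  IsMat G S ∧ ∀ e ∈ S, ∀ f ∈ S, ∀ a ∈ e, ∀ b ∈ f, G.Adj a b → e = f

/-- A matching that is empty, or is the union of two nonempty sets without edges of the graph
between them. -/
def IsDisc (G : SimpleGraph V) (S : Finset (Sym2 V)) : Prop :=
  IsMat G S ∧ (S = ∅ ∨ ∃ T ⊆ S, T.Nonempty ∧ T ≠ S ∧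
    ∀ e ∈ T, ∀ f ∈ S, f ∉ T → ∀ a ∈ e, ∀ b ∈ f, ¬ G.Adj a b)

/-- The vertex `v` is covered by the set of edges `S`. -/
def Covered (S : Finset (Sym2 V)) (v : V) : Prop := ∃ e ∈ S, v ∈ e

/-- A largest set with the property `P`. -/
def IsLargest (P : Finset (Sym2 V) → Prop) (S : Finset (Sym2 V)) : Prop :=
  P S ∧ ∀ T, P T → T.card ≤ S.card

theorem IsMat.empty : IsMat G ∅ := by simp [IsMat]

theorem IsInd.empty : IsInd G ∅ := by simp [IsInd, IsMat]

theorem IsDisc.empty : IsDisc G ∅ := ⟨.empty, .inl rfl⟩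

theorem IsMat.subset (h : IsMat G S) (hT : T ⊆ S) : IsMat G T :=
  ⟨fun e he => h.1 e (hT he), fun e he f hf => h.2 e (hT he) f (hT hf)⟩

theorem IsMat.adj (h : IsMat G S) {a b : V} (hab : s(a, b) ∈ S) : G.Adj a b := h.1 _ hab

theorem Covered.exists_mem {v : V} (h : Covered S v) : ∃ w, s(v, w) ∈ S := by
  obtain ⟨e, he, hv⟩ := h
  obtain ⟨w, rfl⟩ := hv
  exact ⟨w, he⟩

theorem IsMat.eq_of_mem (h : IsMat G S) {a b c : V} (hb : s(a, b) ∈ S) (hc : s(a, c) ∈ S) :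
    b = c := by
  exact Sym2.congr_right.1 (h.2 _ hb _ hc a (by simp) (by simp))

theorem IsMat.insert_edge (h : IsMat G S) {a b : V} (hab : G.Adj a b) (ha : ¬ Covered S a)
    (hb : ¬ Covered S b) : IsMat G (insert s(a, b) S) := by
  have key : ∀ e ∈ S, ∀ v, v ∈ s(a, b) → v ∉ e := fun e he v hv hve => by
    rcases Sym2.mem_iff.1 hv with rfl | rfl
    exacts [ha ⟨e, he, hve⟩, hb ⟨e, he, hve⟩]
  refine ⟨fun e he => ?_, fun e he f hf v hve hvf => ?_⟩
  · rcases Finset.mem_insert.1 he with rfl | he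
    exacts [hab, h.1 e he]
  · rcases Finset.mem_insert.1 he with rfl | he <;> rcases Finset.mem_insert.1 hf with rfl | hf
    · rfl
    · exact (key f hf v hve hvf).elim
    · exact (key e he v hvf hve).elim
    · exact h.2 e he f hf v hve hvf

theorem notMem_of_not_covered {a b : V} (ha : ¬ Covered S a) : s(a, b) ∉ S := fun h =>
  ha ⟨_, h, by simp⟩

theorem IsMat.not_covered_erase (h : IsMat G S) {e : Sym2 V} (he : e ∈ S) {a : V} (ha : a ∈ e) :
    ¬ Covered (S.erase e) a := by
  rintro ⟨f, hf, haf⟩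
  exact (Finset.mem_erase.1 hf).1 (h.2 f (Finset.mem_of_mem_erase hf) e he a haf ha)

theorem not_covered_erase_of_not {a : V} (e : Sym2 V) (ha : ¬ Covered S a) : ¬ Covered (S.erase e) a :=
  fun ⟨f, hf, haf⟩ => ha ⟨f, Finset.mem_of_mem_erase hf, haf⟩

/-- Replacing a matching edge by another edge at one of its ends. -/
theorem IsMat.swap (h : IsMat G S) {u v w : V} (hw : s(u, w) ∈ S) (huv : G.Adj u v)
    (hv : ¬ Covered S v) :
    IsMat G (insert s(u, v) (S.erase s(u, w))) ∧
      (insert s(u, v) (S.erase s(u, w))).card = S.card := by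
  have hu := h.not_covered_erase hw (a := u) (by simp)
  refine ⟨(h.subset (Finset.erase_subset _ _)).insert_edge huv hu (not_covered_erase_of_not _ hv), ?_⟩
  rw [Finset.card_insert_of_notMem (notMem_of_not_covered hu), Finset.card_erase_add_one hw]

theorem IsLargest.not_insert (h : IsLargest (IsMat G) S) {a b : V} (hab : G.Adj a b)
    (ha : ¬ Covered S a) : Covered S b := by
  by_contra hb
  have := h.2 _ (h.1.insert_edge hab ha hb)
  rw [Finset.card_insert_of_notMem (notMem_of_not_covered ha)] at this
  omega

theorem exists_isLargest [Finite V] {P : Finset (Sym2 V) → Prop} (h : P S) :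
    ∃ S, IsLargest P S := by
  have := Fintype.ofFinite V
  obtain ⟨T, hT, hmax⟩ := Finset.exists_max_image (Finset.univ.filter P) Finset.card
    ⟨S, by simpa using h⟩
  exact ⟨T, by simpa using hT, fun T' hT' => hmax T' (by simpa using hT')⟩

/-- A vertex lies on at most one edge of a matching, so few vertices meet few edges. -/
theorem IsMat.card_le_of_hit (h : IsMat G S) (hT : T ⊆ S) {Y : Finset V}
    (hY : ∀ e ∈ T, ∃ y ∈ Y, y ∈ e) : T.card ≤ Y.card := by
  rcases T.eq_empty_or_nonempty with rfl | ⟨e, he⟩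
  · simp
  have : Nonempty V := ⟨(hY e he).choose⟩
  choose! g hg using hY
  exact Finset.card_le_card_of_injOn g (fun e he => (hg e he).1) fun e he f hf hef =>
    h.2 e (hT he) f (hT hf) (g e) (hg e he).2 (hef ▸ (hg f hf).2)

/-- The vertices covered by `S`. -/
noncomputable def cover (S : Finset (Sym2 V)) : Finset V := S.biUnion Sym2.toFinset

theorem mem_cover {v : V} : v ∈ cover S ↔ Covered S v := by
  simp [cover, Covered]

theorem IsMat.card_cover (h : IsMat G S) : (cover S).card = 2 * S.card := by
  rw [cover, Finset.card_biUnion, Finset.sum_const_nat (m := 2), mul_comm]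
  · exact fun e he => Sym2.card_toFinset_of_not_isDiag _ (G.not_isDiag_of_mem_edgeSet (h.1 e he))
  · intro e he f hf hef
    refine Finset.disjoint_left.2 fun v hv hv' => hef ?_
    rw [Sym2.mem_toFinset] at hv hv'
    exact h.2 e he f hf v hv hv'

/-- A subgraph that is a matching, from its set of edges. -/
def IsMat.toSubgraph (h : IsMat G S) : G.Subgraph where
  verts := {v | Covered S v}
  Adj a b := s(a, b) ∈ S
  adj_sub hab := h.adj hab
  edge_vert hab := ⟨_, hab, by simp⟩
  symm := ⟨fun a b hab => by rwa [Sym2.eq_swap]⟩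

theorem IsMat.isMatching_toSubgraph (h : IsMat G S) : h.toSubgraph.IsMatching := by
  intro v hv
  obtain ⟨w, hw⟩ := Covered.exists_mem hv
  exact ⟨w, hw, fun w' hw' => h.eq_of_mem hw' hw⟩

theorem IsMat.ncard_toSubgraph (h : IsMat G S) : h.toSubgraph.edgeSet.ncard = S.card := by
  have : h.toSubgraph.edgeSet = S := by
    ext e; induction e with | _ a b => rfl
  rw [this, Set.ncard_coe_finset]

theorem isMat_of_isMatching {M : G.Subgraph} (hM : M.IsMatching) (hS : (S : Set _) = M.edgeSet) :
    IsMat G S := by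
  have hS' : ∀ e, e ∈ S ↔ e ∈ M.edgeSet := fun e => by rw [← hS]; simp
  refine ⟨fun e he => M.edgeSet_subset ((hS' e).1 he), fun e he f hf v hve hvf => ?_⟩
  obtain ⟨a, rfl⟩ := hve
  obtain ⟨b, rfl⟩ := hvf
  have ha : M.Adj v a := (hS' _).1 he
  have hb : M.Adj v b := (hS' _).1 hf
  rw [(hM (M.edge_vert ha)).unique ha hb]

theorem isInd_iff [Finite V] (k : ℕ) :
    (∃ M : G.Subgraph, IsInducedMatching G M ∧ M.edgeSet.ncard = k) ↔
      ∃ S, IsInd G S ∧ S.card = k := by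
  constructor
  · rintro ⟨M, ⟨hM, hind⟩, rfl⟩
    obtain ⟨S, hS⟩ := M.edgeSet.toFinite.exists_finset_coe
    have hmat := isMat_of_isMatching hM hS
    have hS' : ∀ a b, s(a, b) ∈ S ↔ M.Adj a b := fun a b => by
      rw [← Finset.mem_coe, hS]; rfl
    refine ⟨S, ⟨hmat, fun e he f hf a ha b hb hab => ?_⟩, by rw [← hS, Set.ncard_coe_finset]⟩
    obtain ⟨a', rfl⟩ := ha
    obtain ⟨b', rfl⟩ := hb
    have h₁ := (hS' _ _).1 he
    have h₂ := (hS' _ _).1 hf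
    have := (hind ⟨a, M.edge_vert h₁⟩).unique (y₁ := ⟨a', M.edge_vert h₁.symm⟩)
      (y₂ := ⟨b, M.edge_vert h₂⟩) (M.adj_sub h₁) hab
    rw [Subtype.mk.injEq] at this
    exact hmat.2 _ he _ hf a' (by simp) (by simp [this])
  · rintro ⟨S, ⟨hmat, hind⟩, rfl⟩
    refine ⟨hmat.toSubgraph, ⟨hmat.isMatching_toSubgraph, ?_⟩, hmat.ncard_toSubgraph⟩
    rintro ⟨v, hv⟩
    obtain ⟨w, hw⟩ := Covered.exists_mem hv
    refine ⟨⟨w, _, hw, by simp⟩, hmat.adj hw, ?_⟩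
    rintro ⟨x, f, hf, hxf⟩ hvx
    have hvx : G.Adj v x := hvx
    have := hind _ hw f hf v (by simp) x hxf hvx
    rw [← this, Sym2.mem_iff] at hxf
    exact Subtype.ext (hxf.resolve_left hvx.ne')

/-- For one direction T consists of the edges that meet the component of a vertex u in G[M], where u
and v are not connected. For the other, being covered by T propagates along walks. -/
theorem isDisc_iff [Finite V] (k : ℕ) :
    (∃ M : G.Subgraph, IsDisconnectedMatching G M ∧ M.edgeSet.ncard = k) ↔
      ∃ S, IsDisc G S ∧ S.card = k := by
  constructor
  · rintro ⟨M, ⟨hM, hdisc⟩, rfl⟩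
    obtain ⟨S, hS⟩ := M.edgeSet.toFinite.exists_finset_coe
    have hmat := isMat_of_isMatching hM hS
    have hS' : ∀ a b, s(a, b) ∈ S ↔ M.Adj a b := fun a b => by
      rw [← Finset.mem_coe, hS]; rfl
    refine ⟨S, ⟨hmat, ?_⟩, by rw [← hS, Set.ncard_coe_finset]⟩
    have hv : ∀ e ∈ S, ∀ v ∈ e, v ∈ M.verts := fun e he v hve => by
      obtain ⟨w, rfl⟩ := hve
      exact M.edge_vert ((hS' _ _).1 he)
    rcases hdisc with h | h
    · refine .inl (Finset.eq_empty_of_forall_notMem fun e he => ?_)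
      induction e with
      | _ a b => simpa [h] using hv _ he a (by simp)
    · right
      simp only [SimpleGraph.Preconnected, not_forall] at h
      obtain ⟨⟨u, hu⟩, ⟨v, hvM⟩, huv⟩ := h
      let R : V → Prop := fun a => ∃ ha : a ∈ M.verts,
        (G.induce M.verts).Reachable ⟨u, hu⟩ ⟨a, ha⟩
      have hR : ∀ a b, R a → b ∈ M.verts → G.Adj a b → R b := fun a b ⟨ha, hra⟩ hb hab =>
        ⟨hb, hra.trans (SimpleGraph.Adj.reachable (by exact hab))⟩
      have hRe : ∀ e ∈ S, ∀ a ∈ e, ∀ b ∈ e, R a → R b := fun e he a ha b hb hRa => by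
        obtain ⟨w, rfl⟩ := ha
        rcases Sym2.mem_iff.1 hb with rfl | rfl
        · exact hRa
        · exact hR a b hRa (hv _ he b hb) (hmat.adj he)
      refine ⟨S.filter fun e => ∃ a ∈ e, R a, Finset.filter_subset _ _, ?_, fun hT => ?_,
        fun e he f hf hfT a ha b hb hab => ?_⟩
      · obtain ⟨w, hw, -⟩ := hM hu
        exact ⟨s(u, w), Finset.mem_filter.2 ⟨(hS' _ _).2 hw, u, by simp, hu, .refl _⟩⟩
      · obtain ⟨w, hw, -⟩ := hM hvM
        have hw' : s(v, w) ∈ S := (hS' _ _).2 hw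
        rw [← hT, Finset.mem_filter] at hw'
        obtain ⟨hw', a, ha, hRa⟩ := hw'
        obtain ⟨_, h⟩ := hRe _ hw' a ha v (by simp) hRa
        exact huv h
      · obtain ⟨he, a', ha', hRa'⟩ := Finset.mem_filter.1 he
        exact hfT (Finset.mem_filter.2 ⟨hf, b, hb,
          hR a b (hRe e he a' ha' a ha hRa') (hv f hf b hb) hab⟩)
  · rintro ⟨S, ⟨hmat, hdisc⟩, rfl⟩
    refine ⟨hmat.toSubgraph, ⟨hmat.isMatching_toSubgraph, ?_⟩, hmat.ncard_toSubgraph⟩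
    rcases hdisc with rfl | ⟨T, hTS, ⟨e, heT⟩, hne, hT⟩
    · left
      ext v
      simp [IsMat.toSubgraph, Covered]
    · right
      intro hconn
      obtain ⟨f, hf, hfT⟩ : ∃ f ∈ S, f ∉ T := by
        by_contra! h
        exact hne (Finset.Subset.antisymm hTS h)
      induction e with
      | _ x x' =>
      induction f with
      | _ y y' =>
      obtain ⟨p⟩ := hconn ⟨x, _, hTS heT, by simp⟩ ⟨y, _, hf, by simp⟩
      have key : ∀ {a b : hmat.toSubgraph.verts}, (G.induce hmat.toSubgraph.verts).Walk a b →
          Covered T a → Covered T b := by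
        intro a b p
        induction p with
        | nil => exact id
        | @cons a b c hab _ ih =>
          rintro ⟨e, he, ha⟩
          obtain ⟨f, hf, hb⟩ := b.2
          refine ih ⟨f, ?_, hb⟩
          by_contra hfT
          exact hT e he f hf hfT a ha b hb hab
      obtain ⟨e', he', hy⟩ := key p ⟨_, heT, by simp⟩
      exact hfT (hmat.2 e' (hTS he') _ hf y hy (by simp) ▸ he')

theorem inducedMatchingNumber_eq [Finite V] (h : IsLargest (IsInd G) S) :
    inducedMatchingNumber G = S.card := by
  rw [inducedMatchingNumber]
  simp only [isInd_iff]
  refine IsGreatest.csSup_eq ⟨⟨S, h.1, rfl⟩, ?_⟩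
  rintro _ ⟨T, hT, rfl⟩
  exact h.2 T hT

theorem disconnectedMatchingNumber_eq [Finite V] (h : IsLargest (IsDisc G) S) :
    disconnectedMatchingNumber G = S.card := by
  rw [disconnectedMatchingNumber]
  simp only [isDisc_iff]
  refine IsGreatest.csSup_eq ⟨⟨S, h.1, rfl⟩, ?_⟩
  rintro _ ⟨T, hT, rfl⟩
  exact h.2 T hT

/-! ### Maximum matchings close to a given matching -/

/-- Some maximum matching contains all edges of `M` but those with both ends covered otherwise. -/
theorem exists_isLargest_near [Finite V] (hM : IsMat G M) :
    ∃ N, IsLargest (IsMat G) N ∧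
      ∀ u v, s(u, v) ∈ M → s(u, v) ∉ N → Covered N u ∧ Covered N v := by
  have := Fintype.ofFinite V
  obtain ⟨N₀, hN₀⟩ := exists_isLargest (IsMat.empty (G := G))
  -- Take a maximum matching sharing as many edges as possible with M. If uv in M has v uncovered,
  -- swapping the edge uw at u for uv would share one more.
  obtain ⟨N, hN, hmax⟩ := Finset.exists_max_image
    (Finset.univ.filter fun N => IsLargest (IsMat G) N) (fun N => (N ∩ M).card)
    ⟨N₀, by simpa using hN₀⟩
  replace hN : IsLargest (IsMat G) N := by simpa using hN
  have key : ∀ u v, s(u, v) ∈ M → s(u, v) ∉ N → Covered N v := fun u v huv huvN => by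
    by_contra hv
    obtain ⟨w, hw⟩ := (hN.not_insert (hM.adj huv).symm hv).exists_mem
    obtain ⟨h₁, h₂⟩ := hN.1.swap hw (hM.adj huv) hv
    have := hmax _ (by
      rw [Finset.mem_filter]
      exact ⟨Finset.mem_univ _, h₁, fun T hT => h₂ ▸ hN.2 T hT⟩)
    refine absurd this (not_le_of_gt (Finset.card_lt_card ?_))
    refine (Finset.ssubset_iff_of_subset fun e he => ?_).2 ⟨s(u, v), by simp [huv], by simp [huvN]⟩
    obtain ⟨heN, heM⟩ := Finset.mem_inter.1 he
    have : e ≠ s(u, w) := by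
      rintro rfl
      exact huvN (hM.eq_of_mem huv heM ▸ hw)
    simp [heN, heM, this]
  exact ⟨N, hN, fun u v huv huvN =>
    ⟨key v u (by rwa [Sym2.eq_swap]) (by rwa [Sym2.eq_swap]), key u v huv huvN⟩⟩

/-- Every end of an edge in M \ N lies on an edge of N \ M. No such edge contains two of these ends:
as M is induced, it would belong to M. -/
theorem two_mul_card_sdiff_le (hM : IsInd G M) (hN : IsMat G N)
    (hMN : ∀ u v, s(u, v) ∈ M → s(u, v) ∉ N → Covered N u ∧ Covered N v) :
    2 * (M \ N).card ≤ (N \ M).card := by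
  rw [← (hM.1.subset Finset.sdiff_subset).card_cover]
  have h : ∀ u ∈ cover (M \ N), ∃ e ∈ N \ M, u ∈ e := fun u hu => by
    obtain ⟨v, huv⟩ := (mem_cover.1 hu).exists_mem
    obtain ⟨huvM, huvN⟩ := Finset.mem_sdiff.1 huv
    obtain ⟨e, he, hue⟩ := (hMN u v huvM huvN).1
    refine ⟨e, Finset.mem_sdiff.2 ⟨he, fun heM => huvN ?_⟩, hue⟩
    rwa [← hM.1.2 e heM _ huvM u hue (by simp)]
  rcases (cover (M \ N)).eq_empty_or_nonempty with h0 | ⟨u, hu⟩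
  · simp [h0]
  have : Nonempty (Sym2 V) := ⟨(h u hu).choose⟩
  choose! g hg hug using h
  refine Finset.card_le_card_of_injOn g hg fun u hu u' hu' huu' => ?_
  by_contra hne
  have hgu : g u = s(u, u') :=
    (Sym2.mem_and_mem_iff hne).1 ⟨hug u hu, huu' ▸ hug u' hu'⟩
  obtain ⟨hN', hM'⟩ := Finset.mem_sdiff.1 (hg u hu)
  rw [hgu] at hN' hM'
  obtain ⟨v, hv⟩ := (mem_cover.1 hu).exists_mem
  obtain ⟨v', hv'⟩ := (mem_cover.1 hu').exists_mem
  have hv := (Finset.mem_sdiff.1 hv).1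
  have hv' := (Finset.mem_sdiff.1 hv').1
  have := hM.2 _ hv _ hv' u (by simp) u' (by simp) (hN.adj hN')
  have h' : u' ∈ s(u, v) := this ▸ by simp
  rw [Sym2.mem_iff] at h'
  rcases h' with h' | h'
  · exact hne h'.symm
  · exact hM' (h' ▸ hv)

/-- Induced matchings with at least two edges are disconnected. -/
theorem IsInd.isDisc (h : IsInd G S) (h2 : 2 ≤ S.card) : IsDisc G S := by
  obtain ⟨e, he⟩ : S.Nonempty := Finset.card_pos.1 (by omega)
  refine ⟨h.1, .inr ⟨{e}, by simpa using he, by simp, fun h => ?_, ?_⟩⟩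
  · rw [← h] at h2
    simp at h2
  · intro e' he' f hf hfe a ha b hb hab
    obtain rfl := Finset.mem_singleton.1 he'
    exact hfe (Finset.mem_singleton.2 (h.2 _ he f hf a ha b hb hab).symm)

/-! ### Bounded degree and large matchings -/

variable [Fintype V]

/-- If an induced matching is not much smaller than the maximum matchings and these are large, then
some maximum matching is disconnected. -/
theorem exists_isDisc_isLargest {D c : ℕ} (hD : G.maxDegree ≤ D) (hM : IsInd G M)
    (hN : IsLargest (IsMat G) N) (hMN : N.card ≤ M.card + c) (hc : 2 * c + 4 * c * D < N.card)
    (h2 : 2 ≤ N.card) : ∃ N', IsDisc G N' ∧ N'.card = N.card := by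
  obtain ⟨N', hN', hnear⟩ := exists_isLargest_near hM.1
  have hcard : N'.card = N.card := le_antisymm (hN.2 _ hN'.1) (hN'.2 _ hN.1)
  refine ⟨N', ⟨hN'.1, .inr ?_⟩, hcard⟩
  -- This and the cardinality bound leave at most c edges in M \ N' and 2c in N' \ M. The latter
  -- cover at most 4c vertices, which have at most 4cD neighbours.
  have h₁ := two_mul_card_sdiff_le hM hN'.1 hnear
  have h₂ := Finset.card_sdiff_add_card_inter M N'
  have h₃ := Finset.card_sdiff_add_card_inter N' M
  rw [Finset.inter_comm] at h₃
  let Y := (cover (N' \ M)).biUnion fun v => G.neighborFinset v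
  have hY : Y.card ≤ 4 * c * D := by
    refine (Finset.card_biUnion_le_card_mul _ _ D fun v _ =>
      (G.degree_le_maxDegree v).trans hD).trans ?_
    rw [(hN'.1.subset Finset.sdiff_subset).card_cover]
    exact Nat.mul_le_mul_right _ (by omega)
  -- M ∩ N' has more than 4cD edges, so some edge e avoids Y and is not joined to N' \ M. It is not
  -- joined to the rest of M as M is induced.
  obtain ⟨e, he, heY⟩ : ∃ e ∈ M ∩ N', ∀ y ∈ Y, y ∉ e := by
    by_contra! h
    have := hN'.1.card_le_of_hit Finset.inter_subset_right h
    omega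
  obtain ⟨heM, heN⟩ := Finset.mem_inter.1 he
  refine ⟨{e}, by simpa using heN, by simp, fun h => ?_, ?_⟩
  · rw [← h] at hcard
    simp at hcard
    omega
  · intro e' he' f hf hfe a ha b hb hab
    obtain rfl := Finset.mem_singleton.1 he'
    by_cases hfM : f ∈ M
    · exact hfe (Finset.mem_singleton.2 (hM.2 _ heM f hfM a ha b hb hab).symm)
    · refine heY a (Finset.mem_biUnion.2 ⟨b, mem_cover.2 ⟨f, by simp [hf, hfM], hb⟩, ?_⟩) ha
      simpa using hab.symm

/-- Keep one edge ab and drop all other edges meeting the at most 2D neighbours of a and b; then ab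
is isolated from what remains. -/
theorem exists_isDisc_near {D : ℕ} (hD : G.maxDegree ≤ D) (hN : IsMat G N)
    (hc : 2 * D < N.card) : ∃ T, IsDisc G T ∧ N.card ≤ T.card + 2 * D := by
  obtain ⟨e, he⟩ : N.Nonempty := Finset.card_pos.1 (by omega)
  induction e with
  | _ a b =>
  let Y := G.neighborFinset a ∪ G.neighborFinset b
  have hY : Y.card ≤ 2 * D := by
    have h₁ := (G.degree_le_maxDegree a).trans hD
    have h₂ := (G.degree_le_maxDegree b).trans hD
    rw [← SimpleGraph.card_neighborFinset_eq_degree] at h₁ h₂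
    exact (Finset.card_union_le (G.neighborFinset a) (G.neighborFinset b)).trans (by omega)
  have hab := hN.adj he
  let N' := N.filter fun f => ∀ y ∈ Y, y ∉ f
  have hN' : N.card ≤ N'.card + 2 * D := by
    have h₁ := hN.card_le_of_hit (T := N.filter fun f => ¬ ∀ y ∈ Y, y ∉ f) (Y := Y)
      (Finset.filter_subset _ _) fun f hf => by simpa using (Finset.mem_filter.1 hf).2
    have h₂ : N'.card + _ = N.card :=
      Finset.card_filter_add_card_filter_not (s := N) fun f => ∀ y ∈ Y, y ∉ f
    omega
  have hfar : ∀ f ∈ N', ∀ y ∈ Y, y ∉ f := fun f hf => (Finset.mem_filter.1 hf).2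
  have hnot : s(a, b) ∉ N' := fun h => hfar _ h a (by simp [Y, hab.symm]) (by simp)
  have hsub : insert s(a, b) N' ⊆ N :=
    Finset.insert_subset he (Finset.filter_subset _ _)
  refine ⟨insert s(a, b) N', ⟨hN.subset hsub, .inr ⟨{s(a, b)}, by simp, by simp, fun h => ?_, ?_⟩⟩,
    ?_⟩
  · have := congrArg Finset.card h
    rw [Finset.card_insert_of_notMem hnot, Finset.card_singleton] at this
    omega
  · intro e' he' f hf hfe x hx y hy hxy
    obtain rfl := Finset.mem_singleton.1 he'
    have hfN := (Finset.mem_insert.1 hf).resolve_left fun h => hfe (by simp [h])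
    refine hfar f hfN y ?_ hy
    rcases Sym2.mem_iff.1 hx with rfl | rfl <;> simp [Y, hxy]
  · rw [Finset.card_insert_of_notMem hnot]
    omega

/-- If the matching number is large, then equality of the disconnected and the induced matching
number means that they are equal to the matching number. -/
theorem numbers_eq_iff {D : ℕ} (hD : G.maxDegree ≤ D)
    (hN : IsMat G N) (hc : 8 * D ^ 2 + 4 * D + 2 ≤ N.card) :
    disconnectedMatchingNumber G = inducedMatchingNumber G ↔
      ∃ M, IsInd G M ∧ IsLargest (IsMat G) M := by
  obtain ⟨S, hS⟩ := exists_isLargest (IsInd.empty (G := G))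
  obtain ⟨T, hT⟩ := exists_isLargest (IsDisc.empty (G := G))
  obtain ⟨L, hL⟩ := exists_isLargest (IsMat.empty (G := G))
  have hLc := hL.2 N hN
  rw [inducedMatchingNumber_eq hS, disconnectedMatchingNumber_eq hT]
  constructor
  · intro hST
    obtain ⟨T', hT', hT'c⟩ := exists_isDisc_near hD hL.1 (by nlinarith)
    have h₁ := hT.2 T' hT'
    -- Here c = 2D is the loss in `exists_isDisc_near`, and 2c + 4cD = 8D² + 4D.
    obtain ⟨L', hL', hL'c⟩ := exists_isDisc_isLargest (c := 2 * D) hD hS.1 hL (by omega)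
      (by nlinarith) (by omega)
    have h₂ := hT.2 L' hL'
    exact ⟨S, hS.1, hS.1.1, fun R hR => (hL.2 R hR).trans (by omega)⟩
  · rintro ⟨M, hM, hMl⟩
    have h₁ := hS.2 M hM
    have h₂ := hMl.2 L hL.1
    have h₃ := hT.2 S (hS.1.isDisc (by omega))
    have h₄ := hMl.2 T hT.1.1
    omega

end Matchings


section LocalStructure

open scoped Classical

variable {V W : Type} {G : SimpleGraph V} {H : SimpleGraph W} {S M : Finset (Sym2 V)}

/-! ### Graphs with an induced maximum matching -/

/-- An edge `uv` that is not the middle edge of a path on four vertices. -/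
def Good (G : SimpleGraph V) (u v : V) : Prop :=
  G.Adj u v ∧ ∀ r s, G.Adj u r → r ≠ v → G.Adj v s → s ≠ u → r = s

theorem Good.symm {u v : V} (h : Good G u v) : Good G v u :=
  ⟨h.1.symm, fun r s hr hrn hs hsn => (h.2 s r hs hsn hr hrn).symm⟩

/-- Every edge meets a good edge, and disjoint good edges are not joined by an edge. -/
def GoodCover (G : SimpleGraph V) : Prop :=
  (∀ x y, G.Adj x y → ∃ z w, Good G z w ∧ (z = x ∨ z = y)) ∧
  ∀ a b c d, Good G a b → Good G c d → a ≠ c → a ≠ d → b ≠ c → b ≠ d → ¬ G.Adj a c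

/-- A good edge can be exchanged into an induced maximum matching. -/
theorem IsInd.exists_mem_of_good (hM : IsInd G M) (hmax : IsLargest (IsMat G) M) {u v : V}
    (huv : Good G u v) :
    ∃ M', IsInd G M' ∧ IsLargest (IsMat G) M' ∧ s(u, v) ∈ M' ∧
      ∀ e ∈ M, u ∉ e → v ∉ e → e ∈ M' := by
  by_cases hmem : s(u, v) ∈ M
  · exact ⟨M, hM, hmax, hmem, fun e he _ _ => he⟩
  wlog hu : Covered M u generalizing u v
  · have hv := hmax.not_insert huv.1 hu
    obtain ⟨M', h₁, h₂, h₃, h₄⟩ := this huv.symm (by rwa [Sym2.eq_swap]) hv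
    exact ⟨M', h₁, h₂, by rwa [Sym2.eq_swap], fun e he hue hve => h₄ e he hve hue⟩
  obtain ⟨w, hw⟩ := hu.exists_mem
  have hwv : w ≠ v := by rintro rfl; exact hmem hw
  -- An edge of M at v would be joined to uw by uv, although M is induced.
  have hv : ¬ Covered M v := by
    rintro ⟨f, hf, hvf⟩
    rw [← hM.2 _ hw f hf u (by simp) v hvf huv.1, Sym2.mem_iff] at hvf
    rcases hvf with h | h
    exacts [huv.1.ne h.symm, hwv h.symm]
  obtain ⟨h₁, h₂⟩ := hM.1.swap hw huv.1 hv
  have key : ∀ f ∈ M.erase s(u, w), ∀ x ∈ s(u, v), ∀ y ∈ f, ¬ G.Adj x y := by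
    intro f hf x hx y hy hxy
    obtain ⟨hne, hfM⟩ := Finset.mem_erase.1 hf
    rcases Sym2.mem_iff.1 hx with rfl | rfl
    · exact hne (hM.2 _ hw f hfM x (by simp) y hy hxy).symm
    · have hyu : y ≠ u := by
        rintro rfl
        exact hne (hM.1.2 f hfM _ hw y hy (by simp))
      -- Otherwise w, u, v, y would be a path with middle edge uv.
      obtain rfl := huv.2 w y (hM.1.adj hw) hwv hxy hyu
      exact hne (hM.1.2 f hfM _ hw w hy (by simp))
  refine ⟨_, ⟨h₁, fun e he f hf a ha b hb hab => ?_⟩, ⟨h₁, fun T hT => h₂ ▸ hmax.2 T hT⟩,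
    by simp, fun e he hue _ => ?_⟩
  · rcases Finset.mem_insert.1 he with rfl | he <;> rcases Finset.mem_insert.1 hf with rfl | hf
    · rfl
    · exact (key f hf a ha b hb hab).elim
    · exact (key e he b hb a ha hab.symm).elim
    · exact hM.2 e (Finset.mem_of_mem_erase he) f (Finset.mem_of_mem_erase hf) a ha b hb hab
  · refine Finset.mem_insert_of_mem (Finset.mem_erase.2 ⟨?_, he⟩)
    rintro rfl
    exact hue (by simp)

/-- The edges of an induced maximum matching are good. -/
theorem IsInd.good (hM : IsInd G M) (hmax : IsLargest (IsMat G) M) {u v : V}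
    (huv : s(u, v) ∈ M) : Good G u v := by
  refine ⟨hM.1.adj huv, fun r s hur hrv hvs hsu => ?_⟩
  by_contra hrs
  have hr : ¬ Covered M r := by
    rintro ⟨f, hf, hrf⟩
    rw [← hM.2 _ huv f hf u (by simp) r hrf hur, Sym2.mem_iff] at hrf
    rcases hrf with h | h
    exacts [hur.ne h.symm, hrv h]
  have hs : ¬ Covered M s := by
    rintro ⟨f, hf, hsf⟩
    rw [← hM.2 _ huv f hf v (by simp) s hsf hvs, Sym2.mem_iff] at hsf
    rcases hsf with h | h
    exacts [hsu h, hvs.ne h.symm]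
  -- In a path r, u, v, s the ends r and s are uncovered, so replacing uv by ur and adding vs would
  -- enlarge M.
  obtain ⟨h₁, h₂⟩ := hM.1.swap huv hur hr
  have hlarge : IsLargest (IsMat G) (insert s(u, r) (M.erase s(u, v))) :=
    ⟨h₁, fun T hT => h₂ ▸ hmax.2 T hT⟩
  have hcov : ∀ x, ¬ Covered (M.erase s(u, v)) x → x ≠ u → x ≠ r →
      ¬ Covered (insert s(u, r) (M.erase s(u, v))) x := by
    rintro x hx hxu hxr ⟨e, he, hxe⟩
    rcases Finset.mem_insert.1 he with rfl | he
    · rcases Sym2.mem_iff.1 hxe with h | h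
      exacts [hxu h, hxr h]
    · exact hx ⟨e, he, hxe⟩
  exact hcov s (not_covered_erase_of_not _ hs) hsu (Ne.symm hrs)
    (hlarge.not_insert hvs (hcov v (hM.1.not_covered_erase huv (by simp)) (hM.1.adj huv).ne'
      hrv.symm))

theorem IsInd.goodCover (hM : IsInd G M) (hmax : IsLargest (IsMat G) M) : GoodCover G := by
  constructor
  · intro x y hxy
    by_cases hx : Covered M x
    · obtain ⟨w, hw⟩ := hx.exists_mem
      exact ⟨x, w, hM.good hmax hw, .inl rfl⟩
    · obtain ⟨w, hw⟩ := (hmax.not_insert hxy hx).exists_mem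
      exact ⟨y, w, hM.good hmax hw, .inr rfl⟩
  · intro a b c d hab hcd hac had hbc hbd hadj
    -- Exchange ab into M and then cd; the second exchange keeps ab, which is disjoint from cd. An
    -- induced matching containing both cannot have ac as an edge of the graph.
    obtain ⟨M₁, hM₁, hmax₁, h₁, -⟩ := hM.exists_mem_of_good hmax hab
    obtain ⟨M₂, hM₂, -, h₂, h₃⟩ := hM₁.exists_mem_of_good hmax₁ hcd
    have := hM₂.2 _ (h₃ _ h₁ (by simp [hac.symm, hbc.symm]) (by simp [had.symm, hbd.symm])) _ h₂ a
      (by simp) c (by simp) hadj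
    have h : c ∈ s(a, b) := this ▸ by simp
    rcases Sym2.mem_iff.1 h with h | h
    exacts [hac h.symm, hbc h.symm]

/-- Take a largest matching M of good edges. Disjoint good edges are not joined, so M is induced; it
is shown to equal a maximum matching N close to it. -/
theorem GoodCover.exists_isInd [Finite V] (h : GoodCover G) :
    ∃ M, IsInd G M ∧ IsLargest (IsMat G) M := by
  obtain ⟨M, ⟨hM, hgood⟩, hmax⟩ := exists_isLargest
    (P := fun S => IsMat G S ∧ ∀ u v, s(u, v) ∈ S → Good G u v) (S := ∅)
    ⟨.empty, by simp⟩
  have hcov : ∀ u v, Good G u v → ¬ Covered M u → Covered M v := fun u v huv hu => by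
    by_contra hv
    have := hmax (insert s(u, v) M) ⟨hM.insert_edge huv.1 hu hv, fun a b hab => by
      rcases Finset.mem_insert.1 hab with hab | hab
      · rcases Sym2.eq_iff.1 hab with ⟨rfl, rfl⟩ | ⟨rfl, rfl⟩
        exacts [huv, huv.symm]
      · exact hgood a b hab⟩
    rw [Finset.card_insert_of_notMem (notMem_of_not_covered hu)] at this
    omega
  refine ⟨M, ⟨hM, fun e he f hf a ha b hb hab => ?_⟩, ?_⟩
  · by_contra hef
    have hdisj : ∀ x ∈ e, ∀ y ∈ f, x ≠ y := by
      rintro x hx _ hy rfl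
      exact hef (hM.2 e he f hf x hx hy)
    obtain ⟨a', rfl⟩ := ha
    obtain ⟨b', rfl⟩ := hb
    exact h.2 a a' b b' (hgood _ _ he) (hgood _ _ hf) (hdisj _ (by simp) _ (by simp))
      (hdisj _ (by simp) _ (by simp)) (hdisj _ (by simp) _ (by simp))
      (hdisj _ (by simp) _ (by simp)) hab
  · obtain ⟨N, hN, hnear⟩ := exists_isLargest_near hM
    -- If uv in M is not in N, both ends are covered by N. Goodness gives these two edges of N the
    -- same other end, which is impossible.
    have hMN : M ⊆ N := fun e he => by
      induction e with
      | _ u v =>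
      by_contra huv
      obtain ⟨hu, hv⟩ := hnear u v he huv
      obtain ⟨r, hr⟩ := hu.exists_mem
      obtain ⟨s, hs⟩ := hv.exists_mem
      have hrv : r ≠ v := by rintro rfl; exact huv hr
      have hsu : s ≠ u := by rintro rfl; exact huv (Sym2.eq_swap ▸ hs)
      obtain rfl := (hgood u v he).2 r s (hN.1.adj hr) hrv (hN.1.adj hs) hsu
      rw [Sym2.eq_swap] at hr hs
      exact (hgood u v he).1.ne (hN.1.eq_of_mem hr hs)
    -- An edge xy of N outside M has uncovered ends, one of them, x, on a good edge xw. Then w is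
    -- covered by some wt in M, and the path y, x, w, t contradicts goodness.
    have hNM : N ⊆ M := fun e he => by
      by_contra heM
      have hunc : ∀ v ∈ e, ¬ Covered M v := fun v hv ⟨f, hf, hvf⟩ =>
        heM (hN.1.2 e he f (hMN hf) v hv hvf ▸ hf)
      obtain ⟨x, w, hxw, hx⟩ : ∃ x w, Good G x w ∧ x ∈ e := by
        induction e with
        | _ x y =>
        obtain ⟨z, w, hzw, hz⟩ := h.1 x y (hN.1.adj he)
        exact ⟨z, w, hzw, Sym2.mem_iff.2 hz⟩
      obtain ⟨y, rfl⟩ := hx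
      have hw := hcov x w hxw (hunc x (by simp))
      obtain ⟨t, ht⟩ := hw.exists_mem
      have hyw : y ≠ w := by rintro rfl; exact hunc y (by simp) hw
      have htx : t ≠ x := by rintro rfl; exact hunc t (by simp) ⟨_, ht, by simp⟩
      obtain rfl := hxw.2 y t (hN.1.adj he) hyw (hM.adj ht) htx
      exact hunc y (by simp) ⟨_, ht, by simp⟩
    rwa [hMN.antisymm hNM]

/-! ### Local embeddings -/

/-- The transfer of matchings along a local embedding. -/
theorem IsMat.exists_image {k : ℕ} (h : LocallyEmbeds k G H) (hS : IsMat G S)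
    (hk : 2 * S.card ≤ k) :
    ∃ g : Sym2 V → Sym2 W, IsMat H (S.image g) ∧ Set.InjOn g S ∧
      ∀ e ∈ S, ∀ f ∈ S, ∀ a ∈ g e, ∀ b ∈ g f, H.Adj a b →
        ∃ a' ∈ e, ∃ b' ∈ f, G.Adj a' b' := by
  obtain ⟨f, hinj, hadj, -⟩ := h (cover S) (by rwa [hS.card_cover])
  have hmem : ∀ e ∈ S, ∀ v ∈ e, v ∈ cover S := fun e he v hv => mem_cover.2 ⟨e, he, hv⟩
  have hdisj : ∀ e ∈ S, ∀ e' ∈ S, ∀ v, v ∈ Sym2.map f e → v ∈ Sym2.map f e' → e = e' := by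
    intro e he e' he' v hv hv'
    obtain ⟨a, ha, rfl⟩ := Sym2.mem_map.1 hv
    obtain ⟨b, hb, hab⟩ := Sym2.mem_map.1 hv'
    obtain rfl := hinj (hmem e' he' b hb) (hmem e he a ha) hab
    exact hS.2 e he e' he' b ha hb
  refine ⟨Sym2.map f, ⟨fun e hi => ?_, fun e hi e' hi' v hv hv' => ?_⟩, fun e he e' he' hee' => ?_,
    fun e he e' he' a ha b hb hab => ?_⟩
  · obtain ⟨e, he, rfl⟩ := Finset.mem_image.1 hi
    induction e with
    | _ a b =>
    exact (hadj a (hmem _ he a (by simp)) b (hmem _ he b (by simp))).2 (hS.adj he)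
  · obtain ⟨e, he, rfl⟩ := Finset.mem_image.1 hi
    obtain ⟨e', he', rfl⟩ := Finset.mem_image.1 hi'
    rw [hdisj e he e' he' v hv hv']
  · induction e with
    | _ a b =>
    exact hdisj _ he e' he' (f a) (by simp) (hee' ▸ by simp)
  · obtain ⟨a', ha', rfl⟩ := Sym2.mem_map.1 ha
    obtain ⟨b', hb', rfl⟩ := Sym2.mem_map.1 hb
    exact ⟨a', ha', b', hb', (hadj a' (hmem e he a' ha') b' (hmem e' he' b' hb')).1 hab⟩

theorem IsInd.exists_card_eq {k : ℕ} (h : LocallyEmbeds k G H) (hS : IsInd G S)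
    (hk : 2 * S.card ≤ k) : ∃ S', IsInd H S' ∧ S'.card = S.card := by
  obtain ⟨g, hg, hinj, hadj⟩ := hS.1.exists_image h hk
  refine ⟨S.image g, ⟨hg, fun e hi f hj a ha b hb hab => ?_⟩, Finset.card_image_of_injOn hinj⟩
  obtain ⟨e, he, rfl⟩ := Finset.mem_image.1 hi
  obtain ⟨f, hf, rfl⟩ := Finset.mem_image.1 hj
  obtain ⟨a', ha', b', hb', hab'⟩ := hadj e he f hf a ha b hb hab
  rw [hS.2 e he f hf a' ha' b' hb' hab']

theorem IsDisc.exists_card_eq {k : ℕ} (h : LocallyEmbeds k G H) (hS : IsDisc G S)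
    (hk : 2 * S.card ≤ k) : ∃ S', IsDisc H S' ∧ S'.card = S.card := by
  obtain ⟨g, hg, hinj, hadj⟩ := hS.1.exists_image h hk
  refine ⟨S.image g, ⟨hg, ?_⟩, Finset.card_image_of_injOn hinj⟩
  rcases hS.2 with rfl | ⟨T, hTS, hT, hne, hcross⟩
  · simp
  refine .inr ⟨T.image g, Finset.image_subset_image hTS, hT.image g, fun hTS' => hne ?_,
    fun e hi f hj hfT a ha b hb hab => ?_⟩
  · refine Finset.eq_of_subset_of_card_le hTS ?_
    rw [← Finset.card_image_of_injOn hinj, ← hTS']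
    exact Finset.card_image_le
  · obtain ⟨e, he, rfl⟩ := Finset.mem_image.1 hi
    obtain ⟨f, hf, rfl⟩ := Finset.mem_image.1 hj
    obtain ⟨a', ha', b', hb', hab'⟩ := hadj e (hTS he) f hf a ha b hb hab
    exact hcross e he f hf (fun h => hfT (Finset.mem_image_of_mem g h)) a' ha' b' hb' hab'

/-- Both clauses of `GoodCover` concern vertices within distance two of an edge. Such a ball has at
most 2(D + 1)² vertices. -/
theorem GoodCover.of_locallyEmbeds [Fintype V] {D k : ℕ} (h : LocallyEmbeds k G H)
    (hD : G.maxDegree ≤ D) (hk : 2 * (D + 1) ^ 2 ≤ k) (hH : GoodCover H) : GoodCover G := by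
  let cl : Finset V → Finset V := fun X => X.biUnion fun x => insert x (G.neighborFinset x)
  have hcl : ∀ X, (cl X).card ≤ X.card * (D + 1) := fun X =>
    Finset.card_biUnion_le_card_mul _ _ _ fun x _ =>
      (Finset.card_insert_le _ _).trans
        (Nat.succ_le_succ ((G.degree_le_maxDegree x).trans hD))
  have hsub : ∀ X, X ⊆ cl X := fun X x hx => Finset.mem_biUnion.2 ⟨x, hx, by simp⟩
  have hnb : ∀ X, ∀ x ∈ X, ∀ y, G.Adj x y → y ∈ cl X := fun X x hx y hxy =>
    Finset.mem_biUnion.2 ⟨x, hx, by simp [hxy]⟩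
  -- Neighbours of vertices in the inner ball stay in the outer one, so f maps their neighbourhoods
  -- onto those in H. Thus goodness transfers in both directions.
  have ball : ∀ x y, ∃ f : V → W, Set.InjOn f (cl (cl {x, y})) ∧
      (∀ u ∈ cl (cl {x, y}), ∀ v ∈ cl (cl {x, y}), H.Adj (f u) (f v) ↔ G.Adj u v) ∧
      ∀ u ∈ cl {x, y}, ∀ w, H.Adj (f u) w → ∃ v, G.Adj u v ∧ f v = w := fun x y => by
    obtain ⟨f, hinj, hadj, hint⟩ := h (cl (cl {x, y})) (by
      have h₁ := hcl (cl {x, y})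
      have h₂ := hcl {x, y}
      have h₃ : ({x, y} : Finset V).card ≤ 2 := Finset.card_le_two
      nlinarith)
    refine ⟨f, hinj, hadj, fun u hu w hw => ?_⟩
    obtain ⟨v, hv, rfl⟩ := hint u (hsub _ hu) (hnb _ u hu) w hw
    exact ⟨v, (hadj u (hsub _ hu) v hv).1 hw, rfl⟩
  constructor
  · intro x y hxy
    obtain ⟨f, hinj, hadj, hint⟩ := ball x y
    have hx : x ∈ cl {x, y} := hsub _ (by simp)
    have hy : y ∈ cl {x, y} := hsub _ (by simp)
    obtain ⟨z', w', hgood, hz⟩ := hH.1 (f x) (f y) ((hadj x (hsub _ hx) y (hsub _ hy)).2 hxy)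
    obtain ⟨z, hzxy, rfl⟩ : ∃ z ∈ ({x, y} : Finset V), f z = z' := by
      rcases hz with rfl | rfl
      exacts [⟨x, by simp, rfl⟩, ⟨y, by simp, rfl⟩]
    have hz₁ := hsub _ hzxy
    obtain ⟨w, hzw, rfl⟩ := hint z hz₁ w' hgood.1
    have hw₁ := hnb _ z hzxy w hzw
    refine ⟨z, w, ⟨hzw, fun r s hr hrw hs hsz => ?_⟩, by simpa using hzxy⟩
    have hr₂ := hnb _ z hz₁ r hr
    have hs₂ := hnb _ w hw₁ s hs
    refine hinj hr₂ hs₂ (hgood.2 (f r) (f s) ((hadj z (hsub _ hz₁) r hr₂).2 hr) ?_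
      ((hadj w (hsub _ hw₁) s hs₂).2 hs) ?_)
    · exact fun h => hrw (hinj hr₂ (hsub _ hw₁) h)
    · exact fun h => hsz (hinj hs₂ (hsub _ hz₁) h)
  · intro a b c d hab hcd hac had hbc hbd hadj'
    obtain ⟨f, hinj, hadj, hint⟩ := ball a c
    have key : ∀ u ∈ ({a, c} : Finset V), ∀ v, Good G u v → Good H (f u) (f v) := by
      intro u hu v huv
      have hu₁ := hsub _ hu
      have hv₁ := hnb _ u hu v huv.1
      refine ⟨(hadj u (hsub _ hu₁) v (hsub _ hv₁)).2 huv.1, fun r s hr hrv hs hsu => ?_⟩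
      obtain ⟨r, hur, rfl⟩ := hint u hu₁ r hr
      obtain ⟨s, hvs, rfl⟩ := hint v hv₁ s hs
      rw [huv.2 r s hur (fun h => hrv (h ▸ rfl)) hvs fun h => hsu (h ▸ rfl)]
    have ha : a ∈ ({a, c} : Finset V) := by simp
    have hc : c ∈ ({a, c} : Finset V) := by simp
    have ha₂ := hsub _ (hsub _ ha)
    have hc₂ := hsub _ (hsub _ hc)
    have hb₂ := hsub _ (hnb _ a ha b hab.1)
    have hd₂ := hsub _ (hnb _ c hc d hcd.1)
    exact hH.2 (f a) (f b) (f c) (f d) (key a ha b hab) (key c hc d hcd)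
      (fun h => hac (hinj ha₂ hc₂ h)) (fun h => had (hinj ha₂ hd₂ h))
      (fun h => hbc (hinj hb₂ hc₂ h)) (fun h => hbd (hinj hb₂ hd₂ h)) ((hadj a ha₂ c hc₂).2 hadj')

variable [Fintype V] [Fintype W]

/-- Whether the disconnected and the induced matching number of a graph of bounded degree are equal
depends only on its local structure. -/
theorem numbers_eq_of_locallyEmbeds {D k : ℕ} (hGH : LocallyEmbeds k G H)
    (hHG : LocallyEmbeds k H G) (hG : G.maxDegree ≤ D) (hH : H.maxDegree ≤ D)
    (hk : 2 * (8 * D ^ 2 + 4 * D + 2) ≤ k) (hk' : 2 * (D + 1) ^ 2 ≤ k)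
    (heq : disconnectedMatchingNumber G = inducedMatchingNumber G) :
    disconnectedMatchingNumber H = inducedMatchingNumber H := by
  have small : ∀ {V W : Type} {G : SimpleGraph V} {H : SimpleGraph W}, LocallyEmbeds k G H →
      ∀ S, IsMat G S → 8 * D ^ 2 + 4 * D + 2 ≤ S.card →
        ∃ S', IsMat H S' ∧ 8 * D ^ 2 + 4 * D + 2 ≤ S'.card := by
    intro V W G H h S hS hc
    -- A subset of exactly the threshold size covers few enough vertices to be transferred.
    obtain ⟨S', hS', hc'⟩ := Finset.exists_subset_card_eq hc
    obtain ⟨g, hg, hinj, -⟩ := (hS.subset hS').exists_image h (by omega)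
    exact ⟨_, hg, by rw [Finset.card_image_of_injOn hinj, hc']⟩
  by_cases hlarge : ∃ N, IsMat G N ∧ 8 * D ^ 2 + 4 * D + 2 ≤ N.card
  · obtain ⟨N, hN, hc⟩ := hlarge
    obtain ⟨N', hN', hc'⟩ := small hGH N hN hc
    obtain ⟨M, hM, hmax⟩ := (numbers_eq_iff hG hN hc).1 heq
    exact (numbers_eq_iff hH hN' hc').2
      ((hM.goodCover hmax).of_locallyEmbeds hHG hH hk').exists_isInd
  -- In either graph no matching reaches the threshold, so each one can be transferred and both
  -- numbers agree across G and H.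
  · have hsG : ∀ S, IsMat G S → 2 * S.card ≤ k := fun S hS => by
      by_contra hlt
      exact hlarge ⟨S, hS, by omega⟩
    have hsH : ∀ S, IsMat H S → 2 * S.card ≤ k := fun S hS => by
      by_contra hlt
      exact hlarge (small hHG S hS (by omega))
    obtain ⟨S, hS⟩ := exists_isLargest (IsInd.empty (G := G))
    obtain ⟨T, hT⟩ := exists_isLargest (IsDisc.empty (G := G))
    obtain ⟨S', hS', hSc⟩ := hS.1.exists_card_eq hGH (hsG S hS.1.1)
    obtain ⟨T', hT', hTc⟩ := hT.1.exists_card_eq hGH (hsG T hT.1.1)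
    have hSl : IsLargest (IsInd H) S' := ⟨hS', fun R hR => by
      obtain ⟨R', hR', hRc⟩ := hR.exists_card_eq hHG (hsH R hR.1)
      rw [hSc, ← hRc]
      exact hS.2 R' hR'⟩
    have hTl : IsLargest (IsDisc H) T' := ⟨hT', fun R hR => by
      obtain ⟨R', hR', hRc⟩ := hR.exists_card_eq hHG (hsH R hR.1)
      rw [hTc, ← hRc]
      exact hT.2 R' hR'⟩
    rw [inducedMatchingNumber_eq hS, disconnectedMatchingNumber_eq hT] at heq
    rw [inducedMatchingNumber_eq hSl, disconnectedMatchingNumber_eq hTl, hSc, hTc, heq]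

end LocalStructure

end MatchingNumbers

theorem mainTheorem7 (D : ℕ) :
    MatchingNumbers.DecidableInPolyTime
      (fun G : {G : MatchingNumbers.FinGraph // G.maxDegree ≤ D} => G.val.encode)
      (fun G : {G : MatchingNumbers.FinGraph // G.maxDegree ≤ D} =>
        MatchingNumbers.disconnectedMatchingNumber G.val.graph =
          MatchingNumbers.inducedMatchingNumber G.val.graph) := by
  classical
  refine MatchingNumbers.decidableInPolyTime_of_locallyEmbeds
    (k := 2 * (8 * D ^ 2 + 4 * D + 2) + 2 * (D + 1) ^ 2) (by positivity) fun G H hGH hHG hG => ?_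
  have hD : ∀ G : {G : MatchingNumbers.FinGraph // G.maxDegree ≤ D},
      G.val.graph.maxDegree ≤ D := fun G => by
    have := G.2
    rw [MatchingNumbers.FinGraph.maxDegree] at this
    convert this
  refine MatchingNumbers.numbers_eq_of_locallyEmbeds hGH hHG (D := D) ?_ ?_ (by omega) (by omega) hG
  · convert hD G
  · convert hD H
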